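/- Let $D\subset\mathbb C^n$ be a bounded domain (non-empty, open, connected). For $z\in D$, $X\in\mathbb C^n$ let $\kappa_D(z;X)=\inf\{|\alpha| : \exists\,\varphi:\mathbb D\to D \text{ holomorphic},\ \varphi(0)=z,\ \alpha\varphi'(0)=X\}$ be the Kobayashi--Royden metric, and let $k_D(x,y)=\inf_\gamma\int_0^1\kappa_D(\gamma(t);\gamma'(t))\,dt$ be the Kobayashi distance, the infimum being over all piecewise $\mathcal C^1$ curves $\gamma:[0,1]\to D$ with $\gamma(0)=x$, $\gamma(1)=y$. Assume that $D$ is complete hyperbolic, i.e. that $k_D$ is a complete distance on $D$. A geodesic is a map $\sigma:I\to D$ on an interval $I\subset\mathbb R$ with $k_D(\sigma(s),\sigma(t))=|s-t|$ for all $s,t\in I$; it is a geodesic ray if $I=[0,\infty)$ and a geodesic line if $I=\mathbb R$. Assume that $(D,k_D)$ is Gromov hyperbolic, i.e. that for some $\delta$ every side of every geodesic triangle of $(D,k_D)$ lies in the $\delta$-neighbourhood of the union of the other two sides. We say that $D$ has the visibility property if for all $p\neq q$ in $\partial D$ there exist neighbourhoods $U$ of $p$ and $V$ of $q$ in $\mathbb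 C^n$ with $\overline U\cap\overline V=\emptyset$ and a compact set $K\subset D$ such that every geodesic $\gamma:[0,L]\to D$ with $\gamma(0)\in U$ and $\gamma(L)\in V$ satisfies $\gamma([0,L])\cap K\neq\emptyset$. A geodesic loop in $\overline D$ is a geodesic line which has the same cluster set in $\overline D$ at $+\infty$ and at $-\infty$. Fix $z_0\in D$. The Gromov boundary $\partial_G D$ is the set of geodesic rays $\gamma$ with $\gamma(0)=z_0$ modulo the equivalence $\gamma\sim\eta \iff \sup_{t\ge 0}k_D(\gamma(t),\eta(t))<\infty$. The Gromov compactification is $\overline D^G=D\sqcup\partial_G D$ with the following topology. A sequence $(z_k)$ in $D$ converges to $\sigma\in\partial_G D$ if, for all geodesics $\gamma_k:[0,R_k]\to D$ from $z_0$ to $z_k$, every subsequence of $(\gamma_k)$ has a subsequence which converges uniformly on compacta to a geodesic ray in the class $\sigma$ (along it $R_k\to\infty$). A sequence $(\sigma_k)$ in $\partial_G D$ converges to $\sigma\in\partial_G D$ if, for all representatives $\gamma_k\in\sigma_k$, every subsequence of $(\gamma_k)$ has a subsequence which converges uniformly on compacta to a geodesic ray in the class $\sigma$. A set $W\subset\overline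 D^G$ is open if $W\cap D$ is open in $D$ and every sequence in $D$ or in $\partial_G D$ that converges in this sense to a point of $W\cap\partial_G D$ is eventually in $W$. Then, for every $z_0\in D$: 1. $D$ has the visibility property if and only if the identity map of $D$ extends to a continuous surjective map $\Phi:\overline D^G\to\overline D$, where $\overline D$ is the Euclidean closure of $D$. 2. If $\Phi:\overline D^G\to\overline D$ is such a continuous surjective extension, then $\Phi$ is a homeomorphism if and only if there is no geodesic loop in $\overline D$. -/

import Mathlib

open Set Filter Topology MeasureTheory
open scoped ENNReal

/-- Complex Euclidean space `ℂⁿ`. -/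
abbrev CSpace (n : ℕ) : Type := EuclideanSpace ℂ (Fin n)

section Kobayashi

variable {n : ℕ}

/-- The Kobayashi-Royden pseudometric `κ_D(z; X)`: the infimum of `|α|` over all holomorphic maps
`φ` from the unit disc to `D` with `φ 0 = z` and `α φ'(0) = X`. -/
noncomputable def kobayashiRoyden (D : Set (CSpace n)) (z X : CSpace n) : ℝ≥0∞ :=
  sInf {r | ∃ (α : ℂ) (φ : ℂ → CSpace n), DifferentiableOn ℂ φ (Metric.ball 0 1) ∧
    MapsTo φ (Metric.ball 0 1) D ∧ φ 0 = z ∧ α • deriv φ 0 = X ∧ r = ‖α‖ₑ}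

/-- `γ` is piecewise `C¹` on `[0,1]`: it is continuous there, and there is a finite set `S` of
break points such that `γ` is `C¹` (up to the end points) on every closed subinterval of `[0,1]`
whose interior contains no break point. -/
def IsPiecewiseC1 (γ : ℝ → CSpace n) : Prop :=
  ContinuousOn γ (Icc 0 1) ∧ ∃ S : Finset ℝ, ∀ a b : ℝ, 0 ≤ a → b ≤ 1 →
    (∀ s ∈ S, s ∉ Ioo a b) → ContDiffOn ℝ 1 γ (Icc a b)

/-- `γ` restricted to `[0,1]` is a piecewise `C¹` curve in `D` from `x` to `y`. -/
def IsCurveJoining (D : Set (CSpace n)) (x y : CSpace n) (γ : ℝ → CSpace n) : Prop :=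
  IsPiecewiseC1 γ ∧ MapsTo γ (Icc 0 1) D ∧ γ 0 = x ∧ γ 1 = y

/-- The Kobayashi-Royden length `∫₀¹ κ_D(γ(t); γ'(t)) dt` of a curve. -/
noncomputable def kobayashiLength (D : Set (CSpace n)) (γ : ℝ → CSpace n) : ℝ≥0∞ :=
  ∫⁻ t in Icc (0 : ℝ) 1, kobayashiRoyden D (γ t) (deriv γ t)

/-- The Kobayashi pseudodistance, as an extended nonnegative number: the infimum of the lengths of
the piecewise `C¹` curves joining `x` and `y` in `D`. (It is finite if `D` is a domain.) -/
noncomputable def kobayashiEDist (D : Set (CSpace n)) (x y : CSpace n) : ℝ≥0∞ :=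
  sInf {r | ∃ γ : ℝ → CSpace n, IsCurveJoining D x y γ ∧ r = kobayashiLength D γ}

/-- The Kobayashi pseudodistance `k_D(x, y)` of a domain `D`. -/
noncomputable def kobayashiDist (D : Set (CSpace n)) (x y : CSpace n) : ℝ :=
  (kobayashiEDist D x y).toReal

/-! ### `k_D` is a pseudodistance -/

lemma kobayashiRoyden_zero {D : Set (CSpace n)} {z : CSpace n} (hz : z ∈ D) :
    kobayashiRoyden D z 0 = 0 := by
  refine le_antisymm (sInf_le ⟨0, fun _ => z, ?_, ?_, rfl, ?_, ?_⟩) bot_le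
  · exact differentiableOn_const _
  · intro _ _; exact hz
  · simp
  · simp

lemma kobayashiRoyden_smul_le (D : Set (CSpace n)) (z X : CSpace n) {c : ℝ} (hc : c ≠ 0) :
    kobayashiRoyden D z (c • X) ≤ ‖c‖ₑ * kobayashiRoyden D z X := by
  rw [kobayashiRoyden, kobayashiRoyden, sInf_eq_iInf', sInf_eq_iInf',
    ENNReal.mul_iInf_of_ne (by simpa using hc) enorm_ne_top]
  refine le_iInf ?_
  rintro ⟨r, α, φ, h1, h2, h3, h4, rfl⟩
  refine (iInf_le _ ⟨‖(c : ℂ) * α‖ₑ, (c : ℂ) * α, φ, h1, h2, h3, ?_, rfl⟩).trans ?_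
  · simp only
    rw [enorm_mul]
    refine le_of_eq ?_
    congr 1
    rw [← ofReal_norm, ← ofReal_norm, Complex.norm_real]
  · rw [mul_smul, h4]
    ext i
    simp

/-- Change of variables for the length integrand under an affine reparametrization. -/
lemma lintegral_affine_le (D : Set (CSpace n)) (γ δ : ℝ → CSpace n) {c d a b a' b' : ℝ}
    (hc : c ≠ 0) (himg : (fun t : ℝ => c * t + d) '' Ioo a b ⊆ Ioo a' b')
    (hδ : ∀ t ∈ Ioo a b, δ t = γ (c * t + d)) :
    ∫⁻ t in Ioo a b, kobayashiRoyden D (δ t) (deriv δ t) ≤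
      ∫⁻ t in Ioo a' b', kobayashiRoyden D (γ t) (deriv γ t) := by
  have hderiv : ∀ t ∈ Ioo a b, deriv δ t = c • deriv γ (c * t + d) := by
    intro t ht
    have h1 : δ =ᶠ[𝓝 t] fun s => γ (c * s + d) := by
      filter_upwards [isOpen_Ioo.mem_nhds ht] with s hs using hδ s hs
    rw [h1.deriv_eq]
    have h2 := deriv_comp_mul_left c (fun u => γ (u + d)) t
    rw [h2, deriv_comp_add_const]
  calc ∫⁻ t in Ioo a b, kobayashiRoyden D (δ t) (deriv δ t)
      ≤ ∫⁻ t in Ioo a b, ENNReal.ofReal |c| *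
          kobayashiRoyden D (γ (c * t + d)) (deriv γ (c * t + d)) := by
        refine setLIntegral_mono' measurableSet_Ioo fun t ht => ?_
        rw [hderiv t ht, hδ t ht]
        refine (kobayashiRoyden_smul_le D _ _ hc).trans (le_of_eq ?_)
        rw [← ofReal_norm, Real.norm_eq_abs]
    _ = ∫⁻ t in (fun t : ℝ => c * t + d) '' Ioo a b,
          kobayashiRoyden D (γ t) (deriv γ t) := by
        rw [lintegral_image_eq_lintegral_abs_deriv_mul measurableSet_Ioo (f' := fun _ => c)]
        · intro x _
          simpa using (((hasDerivAt_id x).const_mul c).add_const d).hasDerivWithinAt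
        · intro x _ y _ hxy
          have : c * x = c * y := by simpa using hxy
          exact mul_left_cancel₀ hc this
    _ ≤ _ := lintegral_mono_set himg

lemma kobayashiLength_eq_Ioo (D : Set (CSpace n)) (γ : ℝ → CSpace n) :
    kobayashiLength D γ = ∫⁻ t in Ioo (0 : ℝ) 1, kobayashiRoyden D (γ t) (deriv γ t) := by
  rw [kobayashiLength, restrict_Ioo_eq_restrict_Icc]

lemma kobayashiEDist_le (D : Set (CSpace n)) {x y : CSpace n} {γ : ℝ → CSpace n}
    (h : IsCurveJoining D x y γ) : kobayashiEDist D x y ≤ kobayashiLength D γ :=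
  sInf_le ⟨γ, h, rfl⟩

lemma kobayashiEDist_self {D : Set (CSpace n)} {x : CSpace n} (hx : x ∈ D) :
    kobayashiEDist D x x = 0 := by
  refine le_antisymm ((kobayashiEDist_le D (γ := fun _ => x) ?_).trans ?_) bot_le
  · exact ⟨⟨continuousOn_const, ∅, fun _ _ _ _ _ => contDiffOn_const⟩, fun _ _ => hx, rfl, rfl⟩
  · simp [kobayashiLength, kobayashiRoyden_zero hx]

lemma kobayashiEDist_comm_le (D : Set (CSpace n)) (x y : CSpace n) :
    kobayashiEDist D x y ≤ kobayashiEDist D y x := by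
  refine le_sInf ?_
  rintro r ⟨γ, ⟨⟨hcont, S, hS⟩, hD, h0, h1⟩, rfl⟩
  have hmaps : ∀ a b : ℝ, MapsTo (fun t : ℝ => 1 - t) (Icc a b) (Icc (1 - b) (1 - a)) :=
    fun a b t ht => ⟨by linarith [ht.2], by linarith [ht.1]⟩
  have hmaps01 : MapsTo (fun t : ℝ => 1 - t) (Icc 0 1) (Icc 0 1) :=
    fun t ht => ⟨by linarith [ht.2], by linarith [ht.1]⟩
  refine (kobayashiEDist_le D (γ := fun t => γ (1 - t)) ?_).trans ?_
  · refine ⟨⟨?_, S.image (fun s => 1 - s), ?_⟩, ?_, by simpa using h1, by simpa using h0⟩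
    · exact hcont.comp (by fun_prop) hmaps01
    · intro a b ha hb hab
      refine (hS (1 - b) (1 - a) (by linarith) (by linarith) ?_).comp
        (by fun_prop) (hmaps a b)
      intro s hs hs'
      exact hab (1 - s) (Finset.mem_image_of_mem _ hs)
        ⟨by linarith [hs'.2], by linarith [hs'.1]⟩
    · exact hD.comp hmaps01
  · rw [kobayashiLength_eq_Ioo, kobayashiLength_eq_Ioo]
    refine lintegral_affine_le D γ _ (c := -1) (d := 1) (by norm_num) ?_ ?_
    · rintro _ ⟨t, ht, rfl⟩
      exact ⟨by simp only; linarith [ht.2], by simp only; linarith [ht.1]⟩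
    · intro t _
      congr 1
      ring

lemma kobayashiEDist_comm (D : Set (CSpace n)) (x y : CSpace n) :
    kobayashiEDist D x y = kobayashiEDist D y x :=
  le_antisymm (kobayashiEDist_comm_le D x y) (kobayashiEDist_comm_le D y x)

lemma kobayashiEDist_triangle (D : Set (CSpace n)) (x y z : CSpace n) :
    kobayashiEDist D x z ≤ kobayashiEDist D x y + kobayashiEDist D y z := by
  have key : ∀ γ₁ γ₂ : ℝ → CSpace n, IsCurveJoining D x y γ₁ → IsCurveJoining D y z γ₂ →
      kobayashiEDist D x z ≤ kobayashiLength D γ₁ + kobayashiLength D γ₂ := by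
    rintro γ₁ γ₂ ⟨⟨hc₁, S₁, hS₁⟩, hD₁, h0₁, h1₁⟩ ⟨⟨hc₂, S₂, hS₂⟩, hD₂, h0₂, h1₂⟩
    set γ : ℝ → CSpace n := fun t => if t ≤ 1 / 2 then γ₁ (2 * t) else γ₂ (2 * t - 1) with hγ
    have hle : ∀ t : ℝ, t ≤ 1 / 2 → γ t = γ₁ (2 * t) := fun t ht => by simp only [hγ, if_pos ht]
    have hge : ∀ t : ℝ, 1 / 2 ≤ t → γ t = γ₂ (2 * t - 1) := by
      intro t ht
      rcases ht.eq_or_lt with rfl | ht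
      · rw [hle _ le_rfl]; norm_num [h1₁, h0₂]
      · simp only [hγ, if_neg (not_le.2 ht)]
    have hm₁ : ∀ a b : ℝ, MapsTo (fun t : ℝ => 2 * t) (Icc a b) (Icc (2 * a) (2 * b)) :=
      fun a b t ht => ⟨by simp only; linarith [ht.1], by simp only; linarith [ht.2]⟩
    have hm₂ : ∀ a b : ℝ,
        MapsTo (fun t : ℝ => 2 * t - 1) (Icc a b) (Icc (2 * a - 1) (2 * b - 1)) :=
      fun a b t ht => ⟨by simp only; linarith [ht.1], by simp only; linarith [ht.2]⟩
    refine (kobayashiEDist_le D (γ := γ) ⟨⟨?_, ?_⟩, ?_, ?_, ?_⟩).trans ?_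
    · have e1 : ContinuousOn γ (Icc 0 (1 / 2)) := by
        refine ContinuousOn.congr (hc₁.comp (f := fun t : ℝ => 2 * t) (by fun_prop) ?_)
          fun t ht => hle t ht.2
        convert hm₁ 0 (1 / 2) using 2 <;> norm_num
      have e2 : ContinuousOn γ (Icc (1 / 2) 1) := by
        refine ContinuousOn.congr (hc₂.comp (f := fun t : ℝ => 2 * t - 1) (by fun_prop) ?_)
          fun t ht => hge t ht.1
        convert hm₂ (1 / 2) 1 using 2 <;> norm_num
      rw [← Icc_union_Icc_eq_Icc (show (0 : ℝ) ≤ 1 / 2 by norm_num)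
        (show (1 / 2 : ℝ) ≤ 1 by norm_num)]
      exact e1.union_of_isClosed e2 isClosed_Icc isClosed_Icc
    · refine ⟨insert (1 / 2) (S₁.image (fun s => s / 2) ∪ S₂.image (fun s => (s + 1) / 2)), ?_⟩
      intro a b ha hb hab
      have hhalf := hab (1 / 2) (by simp)
      by_cases hb' : b ≤ 1 / 2
      · refine ContDiffOn.congr ((hS₁ (2 * a) (2 * b) (by linarith) (by linarith) ?_).comp
          (f := fun t : ℝ => 2 * t) (by fun_prop) (hm₁ a b)) fun t ht => hle t (ht.2.trans hb')
        intro s hs hs'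
        exact hab (s / 2) (by simp only [Finset.mem_insert, Finset.mem_union, Finset.mem_image]
                              exact Or.inr (Or.inl ⟨s, hs, rfl⟩))
          ⟨by linarith [hs'.1], by linarith [hs'.2]⟩
      · have ha' : 1 / 2 ≤ a := by
          by_contra hcon
          exact hhalf ⟨not_le.1 hcon, not_le.1 hb'⟩
        refine ContDiffOn.congr ((hS₂ (2 * a - 1) (2 * b - 1) (by linarith) (by linarith) ?_).comp
          (f := fun t : ℝ => 2 * t - 1) (by fun_prop) (hm₂ a b))
          fun t ht => hge t (ha'.trans ht.1)
        intro s hs hs'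
        exact hab ((s + 1) / 2)
          (by simp only [Finset.mem_insert, Finset.mem_union, Finset.mem_image]
              exact Or.inr (Or.inr ⟨s, hs, rfl⟩))
          ⟨by linarith [hs'.1], by linarith [hs'.2]⟩
    · intro t ht
      rcases le_total t (1 / 2) with h | h
      · rw [hle t h]; exact hD₁ ⟨by linarith [ht.1], by linarith⟩
      · rw [hge t h]; exact hD₂ ⟨by linarith, by linarith [ht.2]⟩
    · rw [hle 0 (by norm_num)]; simpa using h0₁
    · rw [hge 1 (by norm_num)]; norm_num [h1₂]
    · rw [kobayashiLength_eq_Ioo D γ, kobayashiLength_eq_Ioo D γ₁, kobayashiLength_eq_Ioo D γ₂]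
      rw [show ∫⁻ t in Ioo (0 : ℝ) 1, kobayashiRoyden D (γ t) (deriv γ t) =
        ∫⁻ t in Ioc (0 : ℝ) (1 / 2) ∪ Ioo (1 / 2) 1, kobayashiRoyden D (γ t) (deriv γ t) by
        rw [Ioc_union_Ioo_eq_Ioo (show (0 : ℝ) ≤ 1 / 2 by norm_num)
        (show (1 / 2 : ℝ) < 1 by norm_num)]]
      refine (lintegral_union_le _ _ _).trans (add_le_add ?_ ?_)
      · rw [← restrict_Ioo_eq_restrict_Ioc]
        refine lintegral_affine_le D γ₁ γ (c := 2) (d := 0) (by norm_num) ?_ ?_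
        · rintro _ ⟨t, ht, rfl⟩
          exact ⟨by simp only; linarith [ht.1], by simp only; linarith [ht.2]⟩
        · intro t ht
          rw [hle t ht.2.le, add_zero]
      · refine lintegral_affine_le D γ₂ γ (c := 2) (d := -1) (by norm_num) ?_ ?_
        · rintro _ ⟨t, ht, rfl⟩
          exact ⟨by simp only; linarith [ht.1], by simp only; linarith [ht.2]⟩
        · intro t ht
          rw [hge t ht.1.le, sub_eq_add_neg]
  conv_rhs => rw [kobayashiEDist, kobayashiEDist, sInf_eq_iInf', sInf_eq_iInf']
  refine ENNReal.le_iInf_add_iInf ?_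
  rintro ⟨_, γ₁, h₁, rfl⟩ ⟨_, γ₂, h₂, rfl⟩
  exact key γ₁ γ₂ h₁ h₂

/-! ### Complete hyperbolicity, geodesics, Gromov hyperbolicity -/

/-- Kobayashi hyperbolicity: `k_D` separates the points of `D`. -/
def IsKobayashiHyperbolic (D : Set (CSpace n)) : Prop :=
  ∀ x ∈ D, ∀ y ∈ D, kobayashiDist D x y = 0 → x = y

/-- Complete hyperbolicity: `k_D` is a distance on `D`, and every Cauchy sequence for `k_D`
converges for `k_D` to a point of `D`. -/
def IsCompleteHyperbolic (D : Set (CSpace n)) : Prop :=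
  IsKobayashiHyperbolic D ∧
    ∀ u : ℕ → CSpace n, (∀ i, u i ∈ D) →
      (∀ ε : ℝ, 0 < ε → ∃ N : ℕ, ∀ i ≥ N, ∀ j ≥ N, kobayashiDist D (u i) (u j) < ε) →
      ∃ x ∈ D, Tendsto (fun i => kobayashiDist D (u i) x) atTop (𝓝 0)

/-- `σ`, restricted to the interval `I`, is a geodesic for `k_D`. Only the values of `σ` on `I`
matter. -/
def IsGeodesicOn (D : Set (CSpace n)) (I : Set ℝ) (σ : ℝ → CSpace n) : Prop :=
  MapsTo σ I D ∧ ∀ s ∈ I, ∀ t ∈ I, kobayashiDist D (σ s) (σ t) = |s - t|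

/-- `σ : [0, L] → D` is a geodesic joining `x` and `y`. -/
def IsGeodesicJoining (D : Set (CSpace n)) (x y : CSpace n) (L : ℝ) (σ : ℝ → CSpace n) : Prop :=
  0 ≤ L ∧ IsGeodesicOn D (Icc 0 L) σ ∧ σ 0 = x ∧ σ L = y

/-- `σ : (-∞, ∞) → D` is a geodesic line. -/
def IsGeodesicLine (D : Set (CSpace n)) (σ : ℝ → CSpace n) : Prop :=
  IsGeodesicOn D univ σ

/-- Gromov hyperbolicity of the geodesic space `(D, k_D)`: there is `δ` such that all geodesic
triangles are `δ`-slim, i.e. each side lies in the closed `δ`-neighbourhood of the union of the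
other two. (By cyclic permutation of the vertices it is enough to speak about the first side.) -/
def IsGromovHyperbolic (D : Set (CSpace n)) : Prop :=
  ∃ δ : ℝ, ∀ (x y z : CSpace n) (L₁ L₂ L₃ : ℝ) (σ₁ σ₂ σ₃ : ℝ → CSpace n),
    IsGeodesicJoining D x y L₁ σ₁ → IsGeodesicJoining D y z L₂ σ₂ →
    IsGeodesicJoining D z x L₃ σ₃ → ∀ s ∈ Icc 0 L₁,
      (∃ t ∈ Icc 0 L₂, kobayashiDist D (σ₁ s) (σ₂ t) ≤ δ) ∨
      (∃ t ∈ Icc 0 L₃, kobayashiDist D (σ₁ s) (σ₃ t) ≤ δ)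

/-! ### Visibility and geodesic loops -/

/-- The pair of boundary points `p, q` has visible geodesics. -/
def HasVisibleGeodesics (D : Set (CSpace n)) (p q : CSpace n) : Prop :=
  ∃ U ∈ 𝓝 p, ∃ V ∈ 𝓝 q, closure U ∩ closure V = ∅ ∧
    ∃ K : Set (CSpace n), IsCompact K ∧ K ⊆ D ∧
      ∀ (L : ℝ) (γ : ℝ → CSpace n), 0 ≤ L → IsGeodesicOn D (Icc 0 L) γ → γ 0 ∈ U → γ L ∈ V →
        ((γ '' Icc 0 L) ∩ K).Nonempty

/-- The visibility property: every pair of distinct points of the Euclidean boundary has visible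
geodesics. -/
def HasVisibilityProperty (D : Set (CSpace n)) : Prop :=
  ∀ p ∈ frontier D, ∀ q ∈ frontier D, p ≠ q → HasVisibleGeodesics D p q

/-- The cluster set in the Euclidean closure of `D` of a curve `γ : ℝ → D` along the filter `l`
(`atTop` for `+∞`, `atBot` for `-∞`). -/
def clusterSet (D : Set (CSpace n)) (l : Filter ℝ) (γ : ℝ → CSpace n) : Set (CSpace n) :=
  {p | p ∈ closure D ∧ MapClusterPt p l γ}

/-- A geodesic loop in `closure D`: a geodesic line with the same cluster set at `+∞` and `-∞`. -/
def IsGeodesicLoop (D : Set (CSpace n)) (γ : ℝ → CSpace n) : Prop :=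
  IsGeodesicLine D γ ∧ clusterSet D atTop γ = clusterSet D atBot γ

/-- `D` has no geodesic loops in `closure D`. -/
def HasNoGeodesicLoops (D : Set (CSpace n)) : Prop :=
  ¬ ∃ γ : ℝ → CSpace n, IsGeodesicLoop D γ

/-! ### The Gromov compactification -/

/-- The geodesic rays `γ : [0, ∞) → D` issuing from `z₀`. -/
def GeodesicRay (D : Set (CSpace n)) (z₀ : D) : Type :=
  {γ : ℝ → CSpace n // IsGeodesicOn D (Ici 0) γ ∧ γ 0 = z₀}

/-- Two rays are equivalent if `sup_{t ≥ 0} k_D(γ(t), η(t)) < ∞`. -/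
instance geodesicRaySetoid (D : Set (CSpace n)) (z₀ : D) : Setoid (GeodesicRay D z₀) where
  r γ η := ⨆ t ∈ Ici (0 : ℝ), kobayashiEDist D (γ.1 t) (η.1 t) < ⊤
  iseqv := by
    refine ⟨fun γ => ?_, fun {γ η} h => ?_, fun {γ η θ} h₁ h₂ => ?_⟩
    · refine lt_of_le_of_lt (b := 0) (iSup₂_le fun t ht => ?_) ENNReal.zero_lt_top
      exact (kobayashiEDist_self (γ.2.1.1 ht)).le
    · simpa only [kobayashiEDist_comm D (η.1 _)] using h
    · refine lt_of_le_of_lt (iSup₂_le fun t ht => ?_) (ENNReal.add_lt_top.2 ⟨h₁, h₂⟩)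
      exact (kobayashiEDist_triangle D _ (η.1 t) _).trans (add_le_add
        (le_iSup₂ (f := fun t (_ : t ∈ Ici (0 : ℝ)) => kobayashiEDist D (γ.1 t) (η.1 t)) t ht)
        (le_iSup₂ (f := fun t (_ : t ∈ Ici (0 : ℝ)) => kobayashiEDist D (η.1 t) (θ.1 t)) t ht))

/-- The Gromov boundary `∂_G D`: equivalence classes of geodesic rays from `z₀`. -/
def GromovBoundary (D : Set (CSpace n)) (z₀ : D) : Type :=
  Quotient (geodesicRaySetoid D z₀)

/-- The underlying set `D ∪ ∂_G D` of the Gromov compactification. -/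
inductive GromovCompactification (D : Set (CSpace n)) (z₀ : D) : Type
  | inner (z : D) : GromovCompactification D z₀
  | ideal (σ : GromovBoundary D z₀) : GromovCompactification D z₀

variable {D : Set (CSpace n)} {z₀ : D}

/-- Some ray in the class `σ` is the limit, uniformly on compact subsets of `[0, ∞)`, of the
curves `γ k`. -/
def LimitRayInClass (γ : ℕ → ℝ → CSpace n) (σ : GromovBoundary D z₀) : Prop :=
  ∃ η : GeodesicRay D z₀, Quotient.mk (geodesicRaySetoid D z₀) η = σ ∧
    ∀ T : ℝ, TendstoUniformlyOn γ η.1 atTop (Icc 0 T)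

/-- Convergence of a sequence of points of `D` to a point `σ` of the Gromov boundary: whenever
`γ k : [0, R k] → D` are geodesics joining `z₀` to `z k`, every subsequence of `γ` has a further
subsequence that converges uniformly on compacta (in particular its intervals of definition
exhaust `[0, ∞)`) to a geodesic ray in the class `σ`. -/
def PointsConverge (z : ℕ → D) (σ : GromovBoundary D z₀) : Prop :=
  ∀ (R : ℕ → ℝ) (γ : ℕ → ℝ → CSpace n), (∀ k, IsGeodesicJoining D z₀ (z k) (R k) (γ k)) →
    ∀ φ : ℕ → ℕ, StrictMono φ → ∃ ψ : ℕ → ℕ, StrictMono ψ ∧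
      Tendsto (fun j => R (φ (ψ j))) atTop atTop ∧
      LimitRayInClass (fun j => γ (φ (ψ j))) σ

/-- Convergence of a sequence of points `s k` of the Gromov boundary to a point `σ` of the Gromov
boundary: for all representatives `γ k` of `s k`, every subsequence of `γ` has a further
subsequence that converges uniformly on compacta to a geodesic ray in the class `σ`. -/
def ClassesConverge (s : ℕ → GromovBoundary D z₀) (σ : GromovBoundary D z₀) : Prop :=
  ∀ γ : ℕ → GeodesicRay D z₀, (∀ k, Quotient.mk (geodesicRaySetoid D z₀) (γ k) = s k) →
    ∀ φ : ℕ → ℕ, StrictMono φ → ∃ ψ : ℕ → ℕ, StrictMono ψ ∧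
      LimitRayInClass (fun j => (γ (φ (ψ j))).1) σ

/-- The topology of the Gromov compactification. It is the sequential topology determined by the
convergent sequences: a set is open iff its trace on `D` is open, and every sequence in `D`, and
every sequence in the Gromov boundary, that converges to one of its boundary points is eventually
in the set. -/
instance gromovTopology (D : Set (CSpace n)) (z₀ : D) :
    TopologicalSpace (GromovCompactification D z₀) where
  IsOpen W := IsOpen {z : D | GromovCompactification.inner z ∈ W} ∧
    ∀ σ : GromovBoundary D z₀, GromovCompactification.ideal σ ∈ W →
      (∀ z : ℕ → D, PointsConverge z σ →
        ∀ᶠ k in atTop, GromovCompactification.inner (z k) ∈ W) ∧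
      (∀ s : ℕ → GromovBoundary D z₀, ClassesConverge s σ →
        ∀ᶠ k in atTop, GromovCompactification.ideal (s k) ∈ W)
  isOpen_univ := ⟨by simp, fun _ _ => ⟨fun _ _ => by simp, fun _ _ => by simp⟩⟩
  isOpen_inter := by
    rintro W₁ W₂ ⟨h₁, h₁'⟩ ⟨h₂, h₂'⟩
    refine ⟨h₁.inter h₂, fun σ hσ => ⟨fun z hz => ?_, fun s hs => ?_⟩⟩
    · exact ((h₁' σ hσ.1).1 z hz).and ((h₂' σ hσ.2).1 z hz)
    · exact ((h₁' σ hσ.1).2 s hs).and ((h₂' σ hσ.2).2 s hs)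
  isOpen_sUnion := by
    intro 𝒲 h
    refine ⟨?_, fun σ hσ => ?_⟩
    · have : {z : D | GromovCompactification.inner (z₀ := z₀) z ∈ ⋃₀ 𝒲} =
          ⋃ W ∈ 𝒲, {z : D | GromovCompactification.inner (z₀ := z₀) z ∈ W} := by
        ext z; simp
      rw [this]
      exact isOpen_biUnion fun W hW => (h W hW).1
    · obtain ⟨W, hW, hσW⟩ := hσ
      refine ⟨fun z hz => ?_, fun s hs => ?_⟩
      · exact (((h W hW).2 σ hσW).1 z hz).mono fun k hk => ⟨W, hW, hk⟩
      · exact (((h W hW).2 σ hσW).2 s hs).mono fun k hk => ⟨W, hW, hk⟩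

/-- `Φ` is a continuous surjective extension of the identity map of `D` to a map from the Gromov
compactification onto the Euclidean closure of `D`. -/
def IsContinuousSurjectiveExtension (Φ : GromovCompactification D z₀ → closure D) : Prop :=
  Continuous Φ ∧ Function.Surjective Φ ∧
    ∀ z : D, (Φ (GromovCompactification.inner z) : CSpace n) = z

end Kobayashi

/-! Boundedness gives, through the Schwarz lemma, a lower bound of `k_D` by a multiple of the
Euclidean distance, and affine discs give a local upper bound. So `k_D` is a finite metric inducing
the Euclidean topology. Almost length-minimising curves are almost geodesics, so completeness and
Hopf-Rinow make `(D, k_D)` proper and geodesic (`IsCompleteHyperbolic.isProperGeodesic`), and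
Arzelà-Ascoli applies to geodesics.

Hyperbolicity enters through `HasSlimTriangles.dist_le_two_mul`: if a geodesic from `x` to `y` stays
farther than `r + δ` from `o`, then geodesics from `o` to `x` and to `y` are `2δ`-close up to time
`r`. Hence limits in the Gromov boundary do not depend on the chosen geodesics or representatives,
every sequence escaping in `D` subconverges to an ideal point, and end points of geodesics that
escape every ball subconverge to the same ideal point.

Visibility says that geodesics far from the base point cannot join neighbourhoods of distinct
boundary points (`eq_of_far_geodesics`). Applied to tails of rays, this shows that rays land, that
equivalent rays land together, and that the landing point depends continuously on the class; this is
the extension. Conversely, if visibility fails at `p ≠ q`, escaping geodesics have end points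
tending to `p` and `q` but to one ideal point, whose image would be both.

An extension is always a closed map, by sequential compactness, so it is a homeomorphism exactly
when it is injective. The two ends of a geodesic line are never equivalent, so a loop destroys
injectivity. Conversely, if inequivalent rays land at the same point, geodesics joining their far
points return to a fixed ball and subconverge to a line, both ends of which land at that point. -/

/-! ### Comparison of the Kobayashi metric with the Euclidean one. -/

section KobayashiEstimates

variable {n : ℕ} {D : Set (CSpace n)}

/-- On a bounded set, the Kobayashi-Royden metric dominates a multiple of the Euclidean norm. -/
lemma exists_enorm_le_mul_kobayashiRoyden (hD : Bornology.IsBounded D) :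
    ∃ C : ℝ, 0 < C ∧ ∀ z X : CSpace n, ‖X‖ₑ ≤ ENNReal.ofReal C * kobayashiRoyden D z X := by
  obtain ⟨C, hC⟩ := Metric.isBounded_iff.1 hD
  refine ⟨max C 1, by positivity, fun z X => ?_⟩
  have h0 : ENNReal.ofReal (max C 1) ≠ 0 := by simp
  rw [mul_comm, ← ENNReal.div_le_iff h0 ENNReal.ofReal_ne_top]
  refine le_sInf ?_
  rintro r ⟨α, φ, hφ, hm, h0, rfl, rfl⟩
  refine ENNReal.div_le_of_le_mul ?_
  rw [enorm_smul]
  gcongr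
  rw [← ofReal_norm]
  refine ENNReal.ofReal_le_ofReal ?_
  -- Schwarz lemma: the disc lies in a ball about `φ 0` whose radius is the diameter bound `C`. The
  -- maximum with `1` only keeps the radius positive.
  have := Complex.norm_deriv_le_div_of_mapsTo_ball (R₂ := max C 1) hφ (fun w hw => ?_) one_pos
  · simpa using this
  · exact (hC (hm hw) (hm (by simp))).trans (le_max_left _ _)

/-- The competitor is the affine disc of radius `r` through `z` in the direction `X`. -/
lemma kobayashiRoyden_le_of_ball_subset {z : CSpace n} {r : ℝ} (hr : 0 < r)
    (hz : Metric.ball z r ⊆ D) (X : CSpace n) :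
    kobayashiRoyden D z X ≤ ENNReal.ofReal (‖X‖ / r) := by
  rcases eq_or_ne X 0 with rfl | hX
  · rw [kobayashiRoyden_zero (hz (Metric.mem_ball_self hr))]; exact bot_le
  have hX' : 0 < ‖X‖ := norm_pos_iff.2 hX
  have hd : ∀ w : ℂ, HasDerivAt (fun ζ : ℂ => z + ζ • (((r / ‖X‖ : ℝ) : ℂ) • X))
      (((r / ‖X‖ : ℝ) : ℂ) • X) w := fun w => by
    simpa using ((hasDerivAt_id w).smul_const (((r / ‖X‖ : ℝ) : ℂ) • X)).const_add z
  refine sInf_le ⟨((‖X‖ / r : ℝ) : ℂ), fun ζ => z + ζ • (((r / ‖X‖ : ℝ) : ℂ) • X),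
    fun w _ => (hd w).differentiableAt.differentiableWithinAt, fun w hw => hz ?_, by simp, ?_, ?_⟩
  · rw [mem_ball_iff_norm, add_sub_cancel_left, norm_smul, norm_smul, Complex.norm_real,
      Real.norm_of_nonneg (by positivity), div_mul_cancel₀ _ hX'.ne']
    have : ‖w‖ < 1 := by simpa using hw
    nlinarith
  · rw [(hd 0).deriv, smul_smul, ← Complex.ofReal_mul, div_mul_div_cancel₀ hr.ne',
      div_self hX'.ne', Complex.ofReal_one, one_smul]
  · rw [← ofReal_norm, Complex.norm_real, Real.norm_of_nonneg (by positivity)]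

lemma IsPiecewiseC1.exists_hasDerivAt {γ : ℝ → CSpace n} (h : IsPiecewiseC1 γ) :
    ∃ S : Finset ℝ, ∀ t ∈ Ioo (0 : ℝ) 1 \ S, HasDerivAt γ (deriv γ t) t := by
  obtain ⟨-, S, hS⟩ := h
  refine ⟨S, fun t ht => DifferentiableAt.hasDerivAt ?_⟩
  have hopen : IsOpen (Ioo (0 : ℝ) 1 \ S) := isOpen_Ioo.sdiff S.finite_toSet.isClosed
  obtain ⟨ε, hε, hball⟩ := Metric.isOpen_iff.1 hopen t ht
  have hsub : Icc (t - ε / 2) (t + ε / 2) ⊆ Ioo (0 : ℝ) 1 \ S := by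
    refine Subset.trans (fun s hs => ?_) hball
    rw [Metric.mem_ball, Real.dist_eq, abs_lt]
    constructor <;> linarith [hs.1, hs.2]
  have h1 := hsub (left_mem_Icc.2 (by linarith))
  have h2 := hsub (right_mem_Icc.2 (by linarith))
  refine ((hS (t - ε / 2) (t + ε / 2) h1.1.1.le h2.1.2.le fun s hs hs' =>
    (hsub (Ioo_subset_Icc_self hs')).2 hs).differentiableOn one_ne_zero).differentiableAt ?_
  exact Icc_mem_nhds (by linarith) (by linarith)

/-- Fundamental theorem of calculus off the finite set of break points. If the integral is infinite
there is nothing to prove; otherwise the derivative is integrable. -/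
lemma enorm_sub_le_lintegral_deriv_of_isPiecewiseC1 {γ : ℝ → CSpace n} (h : IsPiecewiseC1 γ) :
    ‖γ 1 - γ 0‖ₑ ≤ ∫⁻ t in Icc (0 : ℝ) 1, ‖deriv γ t‖ₑ := by
  obtain ⟨S, hS⟩ := h.exists_hasDerivAt
  rcases eq_or_ne (∫⁻ t in Icc (0 : ℝ) 1, ‖deriv γ t‖ₑ) ⊤ with htop | htop
  · rw [htop]; exact le_top
  have hint : IntegrableOn (deriv γ) (Icc 0 1) :=
    ⟨(stronglyMeasurable_deriv γ).aestronglyMeasurable, htop.lt_top⟩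
  rw [← integral_eq_of_hasDerivAt_off_countable_of_le γ (deriv γ) zero_le_one
    S.countable_toSet h.1 hS
    ((intervalIntegrable_iff_integrableOn_Icc_of_le zero_le_one).2 hint),
    intervalIntegral.integral_of_le zero_le_one, ← integral_Icc_eq_integral_Ioc]
  exact enorm_integral_le_lintegral_enorm _

lemma exists_enorm_sub_le_mul_kobayashiEDist (hD : Bornology.IsBounded D) :
    ∃ C : ℝ, 0 < C ∧ ∀ x y : CSpace n,
      ‖x - y‖ₑ ≤ ENNReal.ofReal C * kobayashiEDist D x y := by
  obtain ⟨C, hC, h⟩ := exists_enorm_le_mul_kobayashiRoyden hD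
  refine ⟨C, hC, fun x y => ?_⟩
  rw [mul_comm, ← ENNReal.div_le_iff (by simpa using hC) ENNReal.ofReal_ne_top]
  refine le_sInf ?_
  rintro r ⟨γ, ⟨hγ, -, rfl, rfl⟩, rfl⟩
  refine ENNReal.div_le_of_le_mul ?_
  rw [enorm_sub_rev, mul_comm]
  refine (enorm_sub_le_lintegral_deriv_of_isPiecewiseC1 hγ).trans ?_
  rw [kobayashiLength, ← lintegral_const_mul' _ _ ENNReal.ofReal_ne_top]
  exact lintegral_mono fun t => h _ _

/-- The straight segment is the competitor. The radius `2 * r` leaves room for a ball of radius `r`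
about each of its points. -/
lemma kobayashiEDist_le_of_ball_subset {x y : CSpace n} {r : ℝ} (hr : 0 < r)
    (hx : Metric.ball x (2 * r) ⊆ D) (hy : y ∈ Metric.ball x r) :
    kobayashiEDist D x y ≤ ENNReal.ofReal (‖y - x‖ / r) := by
  have hmem : ∀ t ∈ Icc (0 : ℝ) 1, x + t • (y - x) ∈ Metric.ball x r := fun t ht => by
    rw [mem_ball_iff_norm] at hy ⊢
    rw [add_sub_cancel_left, norm_smul, Real.norm_of_nonneg ht.1]
    nlinarith [ht.2, norm_nonneg (y - x)]
  have hderiv : ∀ t : ℝ, deriv (fun t : ℝ => x + t • (y - x)) t = y - x := fun t => by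
    simpa using (((hasDerivAt_id t).smul_const (y - x)).const_add x).deriv
  have hsub : ∀ z ∈ Metric.ball x r, Metric.ball z r ⊆ D := fun z hz =>
    (Metric.ball_subset_ball' (by rw [Metric.mem_ball] at hz; linarith)).trans hx
  have hc : ContDiff ℝ 1 fun t : ℝ => x + t • (y - x) := by fun_prop
  refine (kobayashiEDist_le D (γ := fun t : ℝ => x + t • (y - x))
    ⟨⟨hc.continuous.continuousOn, ∅, fun _ _ _ _ _ => hc.contDiffOn⟩,
      fun t ht => hsub _ (hmem t ht) (Metric.mem_ball_self hr), by simp, by simp⟩).trans ?_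
  calc kobayashiLength D (fun t : ℝ => x + t • (y - x))
      ≤ ∫⁻ _ in Icc (0 : ℝ) 1, ENNReal.ofReal (‖y - x‖ / r) := by
        refine setLIntegral_mono' measurableSet_Icc fun t ht => ?_
        rw [hderiv]
        exact kobayashiRoyden_le_of_ball_subset hr (hsub _ (hmem t ht)) _
    _ = _ := by simp

/-- Being at finite distance is a symmetric and transitive relation that holds locally, so it holds
throughout a preconnected set. -/
lemma kobayashiEDist_ne_top (hD : IsOpen D) (hc : IsPreconnected D) {x y : CSpace n}
    (hx : x ∈ D) (hy : y ∈ D) : kobayashiEDist D x y ≠ ⊤ := by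
  refine (hc.induction₂ (fun x y => kobayashiEDist D x y < ⊤) (fun x hx => ?_)
    (fun x y z _ _ _ h₁ h₂ => ?_) (fun x y _ _ h => ?_) hx hy).ne
  · obtain ⟨r, hr, hball⟩ := Metric.isOpen_iff.1 hD x hx
    filter_upwards [mem_nhdsWithin_of_mem_nhds (Metric.ball_mem_nhds x (half_pos hr))] with y hy
    refine (kobayashiEDist_le_of_ball_subset (half_pos hr) ?_ hy).trans_lt ENNReal.ofReal_lt_top
    rwa [mul_div_cancel₀ r two_ne_zero]
  · exact (kobayashiEDist_triangle D x y z).trans_lt (ENNReal.add_lt_top.2 ⟨h₁, h₂⟩)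
  · rwa [kobayashiEDist_comm]

lemma kobayashiEDist_le_lintegral {x y : CSpace n} {γ : ℝ → CSpace n}
    (h : IsCurveJoining D x y γ) {a b : ℝ} (ha : 0 ≤ a) (hab : a ≤ b) (hb : b ≤ 1) :
    kobayashiEDist D (γ a) (γ b) ≤ ∫⁻ t in Ioo a b, kobayashiRoyden D (γ t) (deriv γ t) := by
  obtain ⟨⟨hcont, S, hS⟩, hD, -, -⟩ := h
  rcases hab.eq_or_lt with rfl | hab
  · rw [kobayashiEDist_self (hD ⟨ha, hb⟩)]; exact bot_le
  have hpos : 0 < b - a := sub_pos.2 hab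
  have hmaps : ∀ s t : ℝ, MapsTo (fun u : ℝ => (b - a) * u + a) (Icc s t)
      (Icc ((b - a) * s + a) ((b - a) * t + a)) := fun s t u hu =>
    ⟨by simp only; nlinarith [hu.1], by simp only; nlinarith [hu.2]⟩
  have hmaps01 : MapsTo (fun u : ℝ => (b - a) * u + a) (Icc 0 1) (Icc 0 1) := fun u hu =>
    ⟨by simp only; nlinarith [hu.1], by simp only; nlinarith [hu.2]⟩
  refine (kobayashiEDist_le D (γ := fun u => γ ((b - a) * u + a)) ⟨⟨?_, S.image fun s =>
    (s - a) / (b - a), fun s t hs ht hst => ?_⟩, hD.comp hmaps01, by simp, by simp⟩).trans ?_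
  · exact hcont.comp (by fun_prop) hmaps01
  · refine (hS ((b - a) * s + a) ((b - a) * t + a) (by nlinarith) (by nlinarith) ?_).comp
      (by fun_prop) (hmaps s t)
    intro u hu hu'
    refine hst _ (Finset.mem_image_of_mem _ hu) ⟨?_, ?_⟩
    · rw [lt_div_iff₀ hpos]; linarith [hu'.1]
    · rw [div_lt_iff₀ hpos]; linarith [hu'.2]
  · rw [kobayashiLength_eq_Ioo]
    refine lintegral_affine_le D γ _ (c := b - a) (d := a) hpos.ne' ?_ fun t _ => rfl
    rintro _ ⟨t, ht, rfl⟩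
    exact ⟨by simp only; nlinarith [ht.1], by simp only; nlinarith [ht.2]⟩

/-- Length is additive over the three subarcs. This is what turns an almost minimising curve into an
almost geodesic one. -/
lemma kobayashiEDist_add_add_le_kobayashiLength {x y : CSpace n} {γ : ℝ → CSpace n}
    (h : IsCurveJoining D x y γ) {a b : ℝ} (ha : 0 ≤ a) (hab : a ≤ b) (hb : b ≤ 1) :
    kobayashiEDist D x (γ a) + kobayashiEDist D (γ a) (γ b) + kobayashiEDist D (γ b) y ≤
      kobayashiLength D γ := by
  have h1 := kobayashiEDist_le_lintegral h le_rfl ha (hab.trans hb)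
  have h2 := kobayashiEDist_le_lintegral h ha hab hb
  have h3 := kobayashiEDist_le_lintegral h (ha.trans hab) hb le_rfl
  rw [h.2.2.1] at h1
  rw [h.2.2.2] at h3
  refine (add_le_add (add_le_add h1 h2) h3).trans ?_
  rw [← lintegral_union measurableSet_Ioo, ← lintegral_union measurableSet_Ioo,
    kobayashiLength_eq_Ioo]
  · refine lintegral_mono_set (union_subset (union_subset ?_ ?_) ?_) <;>
      exact Ioo_subset_Ioo (by linarith) (by linarith)
  · refine Set.disjoint_left.2 ?_
    rintro t (ht | ht) ht' <;> linarith [ht.2, ht'.1]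
  · exact Set.disjoint_left.2 fun t ht ht' => by linarith [ht.2, ht'.1]

end KobayashiEstimates

/-! ### Hopf-Rinow for complete locally compact length spaces. -/

section LengthSpaces

variable {X : Type*} [MetricSpace X]

/-- Any two points can be joined by a curve that is a geodesic up to an arbitrarily small error. -/
def HasCoarseGeodesics (X : Type*) [MetricSpace X] : Prop :=
  ∀ x y : X, ∀ ε : ℝ, 0 < ε → ∃ f : ℝ → X, f 0 = x ∧ dist (f (dist x y)) y ≤ ε ∧
    ∀ s ∈ Icc 0 (dist x y), ∀ t ∈ Icc 0 (dist x y), |dist (f s) (f t) - (|s - t|)| ≤ ε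

lemma HasCoarseGeodesics.exists_near (h : HasCoarseGeodesics X) (x y : X) {η : ℝ} (hη : 0 < η) :
    ∃ z, dist y z ≤ η ∧ dist x z ≤ max 0 (dist x y - η / 2) := by
  -- Stop `3η/4` before the end of the coarse geodesic: with error `η/8` the point is within `3η/4 +
  -- 2·η/8 = η` of `y`, and the distance to `x` has dropped by at least `5η/8`.
  obtain ⟨f, h0, h1, hf⟩ := h x y (η / 8) (by positivity)
  have hL : (0 : ℝ) ≤ dist x y := dist_nonneg
  have hLm : dist x y ∈ Icc 0 (dist x y) := ⟨hL, le_rfl⟩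
  rcases le_total (dist x y) (3 * η / 4) with hs | hs
  · exact ⟨x, by rw [dist_comm]; linarith, by simp⟩
  · have hsm : dist x y - 3 * η / 4 ∈ Icc 0 (dist x y) := ⟨by linarith, by linarith⟩
    refine ⟨f (dist x y - 3 * η / 4), ?_, le_max_of_le_right ?_⟩
    · have h2 := (abs_le.1 (hf _ hLm _ hsm)).2
      rw [sub_sub_cancel, abs_of_pos (by positivity)] at h2
      have := dist_triangle_left y (f (dist x y - 3 * η / 4)) (f (dist x y))
      linarith
    · have h2 := (abs_le.1 (hf 0 ⟨le_rfl, hL⟩ _ hsm)).2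
      rw [h0, zero_sub, abs_neg, abs_of_nonneg hsm.1] at h2
      linarith

/-- **Hopf-Rinow**: a complete locally compact length space is proper. -/
theorem HasCoarseGeodesics.properSpace [CompleteSpace X] [LocallyCompactSpace X]
    (h : HasCoarseGeodesics X) : ProperSpace X := by
  refine ⟨fun x r => ?_⟩
  by_contra hr
  set B : Set ℝ := {r | ¬ IsCompact (Metric.closedBall x r)} with hB
  have hpos : ∀ r ∈ B, 0 < r := by
    intro r hr
    by_contra hr0
    refine hr ?_
    refine (Metric.subsingleton_closedBall x (not_lt.1 hr0)).finite.isCompact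
  have hbdd : BddBelow B := ⟨0, fun r hr => (hpos r hr).le⟩
  have hne : B.Nonempty := ⟨r, hr⟩
  -- The critical radius: closed balls of smaller radius are compact. The ball of radius `ρ` itself
  -- will be compact, and then slightly larger balls too, which is absurd.
  set ρ := sInf B
  have hlt : ∀ r < ρ, IsCompact (Metric.closedBall x r) := fun r hr => by
    by_contra hcon
    exact (csInf_le hbdd hcon).not_gt hr
  have hρ : IsCompact (Metric.closedBall x ρ) := by
    refine TotallyBounded.isCompact_of_isClosed ?_ Metric.isClosed_closedBall
    refine Metric.totallyBounded_iff.2 fun ε hε => ?_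
    -- Every point of the critical ball lies within `ε/2` of this smaller compact ball, so a finite
    -- `ε/2`-net of the latter is an `ε`-net of the former.
    have hK : IsCompact (Metric.closedBall x (max 0 (ρ - ε / 4))) := by
      rcases le_total (ρ - ε / 4) 0 with hle | hle
      · rw [max_eq_left hle]
        exact (Metric.subsingleton_closedBall x le_rfl).finite.isCompact
      · rw [max_eq_right hle]
        exact hlt _ (by linarith)
    obtain ⟨t, ht, hcov⟩ := Metric.totallyBounded_iff.1 hK.totallyBounded (ε / 2) (by positivity)
    refine ⟨t, ht, fun y hy => ?_⟩
    obtain ⟨z, hyz, hxz⟩ := h.exists_near x y (η := ε / 2) (by positivity)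
    rw [Metric.mem_closedBall, dist_comm] at hy
    have hz : z ∈ Metric.closedBall x (max 0 (ρ - ε / 4)) := by
      rw [Metric.mem_closedBall, dist_comm]
      exact hxz.trans (max_le_max le_rfl (by linarith))
    obtain ⟨w, hw, hzw⟩ := mem_iUnion₂.1 (hcov hz)
    refine mem_iUnion₂.2 ⟨w, hw, ?_⟩
    rw [Metric.mem_ball] at hzw ⊢
    linarith [dist_triangle y z w]
  -- Local compactness yields a compact `δ`-thickening; by the length property it contains the balls
  -- of radius less than `ρ + δ/2`.
  obtain ⟨δ, hδ, hcpt⟩ := hρ.exists_isCompact_cthickening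
  obtain ⟨r, hrB, hrlt⟩ := exists_lt_of_csInf_lt hne (show sInf B < ρ + δ / 2 by
    change ρ < _; linarith)
  refine hrB (hcpt.of_isClosed_subset Metric.isClosed_closedBall fun y hy => ?_)
  obtain ⟨z, hyz, hxz⟩ := h.exists_near x y hδ
  rw [Metric.mem_closedBall, dist_comm] at hy
  refine Metric.mem_cthickening_of_dist_le y z δ _ ?_ hyz
  rw [Metric.mem_closedBall, dist_comm]
  refine hxz.trans (max_le (le_csInf hne fun r hr => (hpos r hr).le) ?_)
  linarith

/-- The geodesic is a pointwise limit, along a nonprincipal ultrafilter, of coarse geodesics with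
errors `1 / (k + 1)`. The ultrafilter gives limits at all times at once, without extracting
subsequences. -/
theorem HasCoarseGeodesics.exists_geodesic [ProperSpace X] (h : HasCoarseGeodesics X) (x y : X) :
    ∃ σ : ℝ → X, σ 0 = x ∧ σ (dist x y) = y ∧
      ∀ s ∈ Icc 0 (dist x y), ∀ t ∈ Icc 0 (dist x y), dist (σ s) (σ t) = |s - t| := by
  have hL : (0 : ℝ) ≤ dist x y := dist_nonneg
  choose f h0 h1 hf using fun k : ℕ => h x y (1 / ((k : ℝ) + 1)) (by positivity)
  have hlim : Tendsto (fun k : ℕ => 1 / ((k : ℝ) + 1)) (hyperfilter ℕ : Filter ℕ) (𝓝 0) :=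
    tendsto_one_div_add_atTop_nhds_zero_nat.mono_left Nat.hyperfilter_le_atTop
  have hex : ∀ s : ℝ, ∃ z : X, s ∈ Icc 0 (dist x y) →
      Tendsto (fun k => f k s) (hyperfilter ℕ : Filter ℕ) (𝓝 z) := by
    intro s
    by_cases hs : s ∈ Icc 0 (dist x y)
    · have hmem : ∀ k, f k s ∈ Metric.closedBall x (dist x y + 1) := fun k => by
        have h2 := (abs_le.1 (hf k s hs 0 ⟨le_rfl, hL⟩)).2
        rw [h0, sub_zero, abs_of_nonneg hs.1] at h2
        have : 1 / ((k : ℝ) + 1) ≤ 1 := by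
          rw [div_le_one (by positivity)]; linarith [k.cast_nonneg (α := ℝ)]
        rw [Metric.mem_closedBall]
        linarith [hs.2]
      obtain ⟨z, -, hz⟩ := (isCompact_closedBall x (dist x y + 1)).ultrafilter_le_nhds'
        ((hyperfilter ℕ).map fun k => f k s) (Ultrafilter.mem_map.2 (univ_mem' hmem))
      exact ⟨z, fun _ => hz⟩
    · exact ⟨x, fun h => absurd h hs⟩
  choose σ hσ using hex
  refine ⟨σ, ?_, ?_, fun s hs t ht => ?_⟩
  · refine tendsto_nhds_unique (hσ 0 ⟨le_rfl, hL⟩) ?_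
    simp only [h0]
    exact tendsto_const_nhds
  · refine tendsto_nhds_unique (hσ _ ⟨hL, le_rfl⟩) ?_
    exact tendsto_iff_dist_tendsto_zero.2
      (squeeze_zero (fun _ => dist_nonneg) h1 hlim)
  · refine tendsto_nhds_unique ((hσ s hs).dist (hσ t ht)) ?_
    refine tendsto_iff_dist_tendsto_zero.2 (squeeze_zero (fun _ => dist_nonneg) (fun k => ?_) hlim)
    exact hf k s hs t ht

end LengthSpaces

/-! ### The Kobayashi distance as a proper geodesic metric. -/

section ProperGeodesicDomains

variable {n : ℕ} {D : Set (CSpace n)}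

lemma kobayashiDist_nonneg (D : Set (CSpace n)) (x y : CSpace n) : 0 ≤ kobayashiDist D x y :=
  ENNReal.toReal_nonneg

lemma kobayashiDist_comm (D : Set (CSpace n)) (x y : CSpace n) :
    kobayashiDist D x y = kobayashiDist D y x := by
  rw [kobayashiDist, kobayashiEDist_comm, kobayashiDist]

lemma kobayashiDist_self {x : CSpace n} (hx : x ∈ D) : kobayashiDist D x x = 0 := by
  rw [kobayashiDist, kobayashiEDist_self hx, ENNReal.toReal_zero]

lemma kobayashiDist_triangle (hfin : ∀ x ∈ D, ∀ y ∈ D, kobayashiEDist D x y ≠ ⊤)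
    {x y z : CSpace n} (hx : x ∈ D) (hy : y ∈ D) (hz : z ∈ D) :
    kobayashiDist D x z ≤ kobayashiDist D x y + kobayashiDist D y z := by
  rw [kobayashiDist, kobayashiDist, kobayashiDist,
    ← ENNReal.toReal_add (hfin x hx y hy) (hfin y hy z hz)]
  exact ENNReal.toReal_mono (ENNReal.add_ne_top.2 ⟨hfin x hx y hy, hfin y hy z hz⟩)
    (kobayashiEDist_triangle D x y z)

lemma exists_norm_sub_le_mul_kobayashiDist (hb : Bornology.IsBounded D)
    (hfin : ∀ x ∈ D, ∀ y ∈ D, kobayashiEDist D x y ≠ ⊤) :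
    ∃ C : ℝ, 0 < C ∧ ∀ x ∈ D, ∀ y ∈ D, ‖x - y‖ ≤ C * kobayashiDist D x y := by
  obtain ⟨C, hC, h⟩ := exists_enorm_sub_le_mul_kobayashiEDist hb
  refine ⟨C, hC, fun x hx y hy => ?_⟩
  have := ENNReal.toReal_mono (ENNReal.mul_ne_top ENNReal.ofReal_ne_top (hfin x hx y hy)) (h x y)
  rwa [toReal_enorm, ENNReal.toReal_mul, ENNReal.toReal_ofReal hC.le] at this

lemma exists_kobayashiDist_le_div (hD : IsOpen D) {x : CSpace n} (hx : x ∈ D) :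
    ∃ r : ℝ, 0 < r ∧ ∀ y ∈ Metric.ball x r, kobayashiDist D x y ≤ ‖y - x‖ / r := by
  obtain ⟨r, hr, hball⟩ := Metric.isOpen_iff.1 hD x hx
  refine ⟨r / 2, half_pos hr, fun y hy => ?_⟩
  refine ENNReal.toReal_le_of_le_ofReal (by positivity)
    (kobayashiEDist_le_of_ball_subset (half_pos hr) ?_ hy)
  rwa [mul_div_cancel₀ r two_ne_zero]

/-- The Kobayashi distance is a metric on `D`, compatible with the Euclidean topology. -/
theorem exists_metricSpace_dist_eq_kobayashiDist (hD : IsOpen D) (hb : Bornology.IsBounded D)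
    (hfin : ∀ x ∈ D, ∀ y ∈ D, kobayashiEDist D x y ≠ ⊤) :
    ∃ (X : Type) (_ : MetricSpace X) (e : X → CSpace n), IsEmbedding e ∧ range e = D ∧
      ∀ x y : X, dist x y = kobayashiDist D (e x) (e y) := by
  obtain ⟨C, hC, hlow⟩ := exists_norm_sub_le_mul_kobayashiDist hb hfin
  refine ⟨D, MetricSpace.ofDistTopology (fun x y : D => kobayashiDist D x y)
    (fun x => kobayashiDist_self x.2) (fun x y => kobayashiDist_comm D x y)
    (fun x y z => kobayashiDist_triangle hfin x.2 y.2 z.2) (fun s => ?_) (fun x y hxy => ?_),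
    Subtype.val, IsEmbedding.subtypeVal, Subtype.range_val, fun _ _ => rfl⟩
  · rw [Metric.isOpen_iff]
    refine forall₂_congr fun x _ => ⟨?_, ?_⟩
    · rintro ⟨ε, hε, h⟩
      refine ⟨ε / C, by positivity, fun y hy => h ?_⟩
      rw [lt_div_iff₀ hC] at hy
      rw [Metric.mem_ball, dist_comm, Subtype.dist_eq, dist_eq_norm]
      linarith [hlow x x.2 y y.2]
    · rintro ⟨ε, hε, h⟩
      obtain ⟨r, hr, hup⟩ := exists_kobayashiDist_le_div hD x.2
      refine ⟨min r (ε * r), by positivity, fun y hy => h y ?_⟩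
      rw [Metric.mem_ball, Subtype.dist_eq] at hy
      refine (hup y (hy.trans_le (min_le_left _ _))).trans_lt ?_
      rw [div_lt_iff₀ hr, ← dist_eq_norm]
      exact hy.trans_le (min_le_right _ _)
  · have := hlow x x.2 y y.2
    rw [hxy, mul_zero, norm_le_zero_iff, sub_eq_zero] at this
    exact Subtype.ext this

lemma continuousOn_kobayashiDist (hD : IsOpen D) (hb : Bornology.IsBounded D)
    (hfin : ∀ x ∈ D, ∀ y ∈ D, kobayashiEDist D x y ≠ ⊤) :
    ContinuousOn (fun p : CSpace n × CSpace n => kobayashiDist D p.1 p.2) (D ×ˢ D) := by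
  obtain ⟨X, m, e, he, hr, hm⟩ := exists_metricSpace_dist_eq_kobayashiDist hD hb hfin
  rw [show D ×ˢ D = Prod.map e e '' univ by rw [image_univ, range_prodMap, hr], (he.prodMap he).isInducing.continuousOn_image_iff,
    continuousOn_univ]
  exact continuous_dist.congr fun p => hm p.1 p.2

/-- On a curve of length less than `k_D(x, y) + ε`, the intermediate value theorem selects for each
`s` a point at distance exactly `s` from `x`. Additivity of length controls the mutual distances. -/
lemma exists_coarse_geodesic (hcont : ContinuousOn
      (fun p : CSpace n × CSpace n => kobayashiDist D p.1 p.2) (D ×ˢ D))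
    (hfin : ∀ x ∈ D, ∀ y ∈ D, kobayashiEDist D x y ≠ ⊤) {x y : CSpace n} (hx : x ∈ D) (hy : y ∈ D)
    {ε : ℝ} (hε : 0 < ε) :
    ∃ f : ℝ → CSpace n, ∀ s ∈ Icc 0 (kobayashiDist D x y), f s ∈ D ∧ kobayashiDist D x (f s) = s ∧
      kobayashiDist D (f s) y ≤ kobayashiDist D x y - s + ε ∧
      ∀ t ∈ Icc 0 (kobayashiDist D x y),
        |kobayashiDist D (f s) (f t) - (|s - t|)| ≤ ε := by
  set L := kobayashiDist D x y with hL
  have hltop : kobayashiEDist D x y < kobayashiEDist D x y + ENNReal.ofReal ε :=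
    ENNReal.lt_add_right (hfin x hx y hy) (by simpa using hε)
  obtain ⟨_, ⟨γ, hγ, rfl⟩, hlen⟩ := sInf_lt_iff.1 hltop
  have hγD : ∀ t ∈ Icc (0 : ℝ) 1, γ t ∈ D := fun t ht => hγ.2.1 ht
  have hsum : ∀ a ∈ Icc (0 : ℝ) 1, ∀ b ∈ Icc (0 : ℝ) 1, a ≤ b →
      kobayashiDist D x (γ a) + kobayashiDist D (γ a) (γ b) + kobayashiDist D (γ b) y ≤ L + ε := by
    intro a ha b hb hab
    have h := (kobayashiEDist_add_add_le_kobayashiLength hγ ha.1 hab hb.2).trans hlen.le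
    have f1 := hfin x hx _ (hγD a ha)
    have f2 := hfin _ (hγD a ha) _ (hγD b hb)
    have f3 := hfin _ (hγD b hb) y hy
    have := ENNReal.toReal_mono (ENNReal.add_ne_top.2 ⟨hfin x hx y hy, ENNReal.ofReal_ne_top⟩) h
    rwa [ENNReal.toReal_add (ENNReal.add_ne_top.2 ⟨f1, f2⟩) f3, ENNReal.toReal_add f1 f2,
      ENNReal.toReal_add (hfin x hx y hy) ENNReal.ofReal_ne_top,
      ENNReal.toReal_ofReal hε.le] at this
  have hIVT : ∀ s ∈ Icc 0 L, ∃ τ ∈ Icc (0 : ℝ) 1, kobayashiDist D x (γ τ) = s := by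
    intro s hs
    have hc : ContinuousOn (fun t => kobayashiDist D x (γ t)) (Icc 0 1) :=
      hcont.comp (f := fun t => (x, γ t)) (continuousOn_const.prodMk hγ.1.1)
        fun t ht => ⟨hx, hγD t ht⟩
    have := intermediate_value_Icc zero_le_one hc
    simp only [hγ.2.2.1, hγ.2.2.2, kobayashiDist_self hx] at this
    exact this hs
  choose! τ hτ1 hτ2 using hIVT
  have tri : ∀ s ∈ Icc 0 L, L - s ≤ kobayashiDist D (γ (τ s)) y := fun s hs => by
    have := kobayashiDist_triangle hfin hx (hγD _ (hτ1 s hs)) hy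
    rw [hτ2 s hs] at this
    linarith
  have main : ∀ s ∈ Icc 0 L, ∀ t ∈ Icc 0 L, s ≤ t →
      |kobayashiDist D (γ (τ s)) (γ (τ t)) - (|s - t|)| ≤ ε := by
    intro s hs t ht hst
    have h1 := kobayashiDist_triangle hfin hx (hγD _ (hτ1 s hs)) (hγD _ (hτ1 t ht))
    rw [hτ2 s hs, hτ2 t ht] at h1
    rw [abs_of_nonpos (sub_nonpos.2 hst), abs_le]
    refine ⟨by linarith, ?_⟩
    -- The selection `τ` need not be monotone; in the reversed order the bound is `ε + s - t`, which
    -- is even smaller since `s ≤ t`.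
    rcases le_total (τ s) (τ t) with h | h
    · have := hsum _ (hτ1 s hs) _ (hτ1 t ht) h
      rw [hτ2 s hs] at this
      linarith [tri t ht]
    · have := hsum _ (hτ1 t ht) _ (hτ1 s hs) h
      rw [hτ2 t ht, kobayashiDist_comm] at this
      linarith [tri s hs]
  refine ⟨fun s => γ (τ s), fun s hs => ⟨hγD _ (hτ1 s hs), hτ2 s hs, ?_, fun t ht => ?_⟩⟩
  · have := hsum _ (hτ1 s hs) _ (hτ1 s hs) le_rfl
    rw [hτ2 s hs, kobayashiDist_self (hγD _ (hτ1 s hs))] at this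
    linarith
  · rcases le_total s t with h | h
    · exact main s hs t ht h
    · rw [kobayashiDist_comm, abs_sub_comm s t]
      exact main t ht s hs h

/-- A bounded open set `D` which, endowed with `k_D`, is a proper geodesic metric space. -/
structure IsProperGeodesic (D : Set (CSpace n)) : Prop where
  isOpen : IsOpen D
  isBounded : Bornology.IsBounded D
  ne_top : ∀ x ∈ D, ∀ y ∈ D, kobayashiEDist D x y ≠ ⊤
  exists_norm_le : ∃ C : ℝ, 0 < C ∧ ∀ x ∈ D, ∀ y ∈ D, ‖x - y‖ ≤ C * kobayashiDist D x y
  continuousOn :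
    ContinuousOn (fun p : CSpace n × CSpace n => kobayashiDist D p.1 p.2) (D ×ˢ D)
  isCompact_closedBall : ∀ x ∈ D, ∀ r : ℝ, IsCompact {y | y ∈ D ∧ kobayashiDist D x y ≤ r}
  exists_geodesic : ∀ x ∈ D, ∀ y ∈ D, ∃ σ, IsGeodesicJoining D x y (kobayashiDist D x y) σ

/-- Everything is transported to an abstract metric space homeomorphic to `D`: local compactness
comes from openness in `ℂⁿ`, completeness from the hypothesis, and Hopf-Rinow does the rest. -/
theorem IsCompleteHyperbolic.isProperGeodesic (hD : IsOpen D) (hconn : IsPreconnected D)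
    (hb : Bornology.IsBounded D) (hc : IsCompleteHyperbolic D) : IsProperGeodesic D := by
  have hfin : ∀ x ∈ D, ∀ y ∈ D, kobayashiEDist D x y ≠ ⊤ :=
    fun x hx y hy => kobayashiEDist_ne_top hD hconn hx hy
  have hcont := continuousOn_kobayashiDist hD hb hfin
  obtain ⟨X, m, e, he, hr, hm⟩ := exists_metricSpace_dist_eq_kobayashiDist hD hb hfin
  have hmem : ∀ x, e x ∈ D := fun x => hr ▸ mem_range_self x
  have hlift : ∀ x ∈ D, ∃ a, e a = x := fun x hx => by rwa [← hr] at hx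
  have hlc : LocallyCompactSpace X :=
    (IsOpenEmbedding.mk he (hr ▸ hD)).locallyCompactSpace
  have hcomplete : CompleteSpace X := by
    refine Metric.complete_of_cauchySeq_tendsto fun u hu => ?_
    obtain ⟨x, hx, hlim⟩ := hc.2 (fun i => e (u i)) (fun i => hmem (u i)) fun ε hε => by
      simpa only [hm] using Metric.cauchySeq_iff.1 hu ε hε
    obtain ⟨a, rfl⟩ := hlift x hx
    refine ⟨a, tendsto_iff_dist_tendsto_zero.2 ?_⟩
    simpa only [hm] using hlim
  have hcoarse : HasCoarseGeodesics X := by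
    intro x y ε hε
    obtain ⟨f, hf⟩ := exists_coarse_geodesic hcont hfin (hmem x) (hmem y) hε
    rw [← hm] at hf
    have : Nonempty X := ⟨x⟩
    choose! g hg using fun s hs => hlift _ (hf s hs).1
    have h0 : (0 : ℝ) ∈ Icc 0 (dist x y) := ⟨le_rfl, dist_nonneg⟩
    refine ⟨g, ?_, ?_, fun s hs t ht => ?_⟩
    · refine (dist_eq_zero.1 ?_).symm
      rw [hm, hg 0 h0]
      exact (hf 0 h0).2.1
    · have h1 : dist x y ∈ Icc 0 (dist x y) := ⟨dist_nonneg, le_rfl⟩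
      rw [hm, hg _ h1]
      simpa using (hf _ h1).2.2.1
    · rw [hm, hg s hs, hg t ht]
      exact (hf s hs).2.2.2 t ht
  have hproper : ProperSpace X := hcoarse.properSpace
  refine ⟨hD, hb, hfin, exists_norm_sub_le_mul_kobayashiDist hb hfin, hcont, fun x hx r => ?_,
    fun x hx y hy => ?_⟩
  · obtain ⟨a, rfl⟩ := hlift x hx
    convert (isCompact_closedBall a r).image he.continuous using 1
    ext y
    constructor
    · rintro ⟨hy, hxy⟩
      obtain ⟨b, rfl⟩ := hlift y hy
      exact ⟨b, by rwa [Metric.mem_closedBall, dist_comm, hm], rfl⟩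
    · rintro ⟨b, hb, rfl⟩
      rw [Metric.mem_closedBall, dist_comm, hm] at hb
      exact ⟨hmem b, hb⟩
  · obtain ⟨a, rfl⟩ := hlift x hx
    obtain ⟨b, rfl⟩ := hlift y hy
    obtain ⟨σ, h0, h1, h⟩ := hcoarse.exists_geodesic a b
    simp only [hm] at h h1
    exact ⟨fun t => e (σ t), kobayashiDist_nonneg _ _ _, ⟨fun t _ => hmem (σ t), h⟩, by simp [h0],
      by simp [h1]⟩

end ProperGeodesicDomains

/-! ### Arzelà-Ascoli and limits of geodesics. -/

section Limits

variable {n : ℕ} {D : Set (CSpace n)}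

namespace IsProperGeodesic

lemma triangle (H : IsProperGeodesic D) {x y z : CSpace n} (hx : x ∈ D) (hy : y ∈ D)
    (hz : z ∈ D) : kobayashiDist D x z ≤ kobayashiDist D x y + kobayashiDist D y z :=
  kobayashiDist_triangle H.ne_top hx hy hz

lemma tendsto_kobayashiDist (H : IsProperGeodesic D) {ι : Type*} {l : Filter ι}
    {u v : ι → CSpace n} {x y : CSpace n} (hu : Tendsto u l (𝓝 x)) (hv : Tendsto v l (𝓝 y))
    (hx : x ∈ D) (hy : y ∈ D) :
    Tendsto (fun i => kobayashiDist D (u i) (v i)) l (𝓝 (kobayashiDist D x y)) :=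
  ((H.continuousOn.continuousAt ((H.isOpen.prod H.isOpen).mem_nhds ⟨hx, hy⟩)).tendsto).comp
    (hu.prodMk_nhds hv)

/-- Sequences that converge to a point outside `D` are unbounded for `k_D`. -/
lemma tendsto_atTop_of_tendsto (H : IsProperGeodesic D) {ι : Type*} {l : Filter ι}
    {u : ι → CSpace n} {o p : CSpace n} (ho : o ∈ D) (hp : p ∉ D) (hu : Tendsto u l (𝓝 p))
    (hD : ∀ᶠ i in l, u i ∈ D) : Tendsto (fun i => kobayashiDist D o (u i)) l atTop := by
  refine tendsto_atTop.2 fun M => ?_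
  have hK := (H.isCompact_closedBall o ho M).isClosed.isOpen_compl.mem_nhds
    (show p ∈ {y | y ∈ D ∧ kobayashiDist D o y ≤ M}ᶜ from fun h => hp h.1)
  filter_upwards [hu.eventually hK, hD] with i hi hiD
  exact (not_le.1 fun h => hi ⟨hiD, h⟩).le

lemma notMem_of_tendsto (H : IsProperGeodesic D) {ι : Type*} {l : Filter ι} [l.NeBot]
    {u : ι → CSpace n} {o p : CSpace n} (ho : o ∈ D) (hu : Tendsto u l (𝓝 p))
    (h : Tendsto (fun i => kobayashiDist D o (u i)) l atTop) : p ∉ D := fun hp =>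
  not_tendsto_nhds_of_tendsto_atTop h _ (H.tendsto_kobayashiDist tendsto_const_nhds hu ho hp)

lemma exists_dist_le_of_isCompact (H : IsProperGeodesic D) {K : Set (CSpace n)} (hK : IsCompact K)
    (hKD : K ⊆ D) {o : CSpace n} (ho : o ∈ D) : ∃ r, ∀ y ∈ K, kobayashiDist D o y ≤ r := by
  have hc : ContinuousOn (fun y => kobayashiDist D o y) K :=
    H.continuousOn.comp (f := fun y => (o, y)) (by fun_prop) fun y hy => ⟨ho, hKD hy⟩
  obtain ⟨r, hr⟩ := (hK.image_of_continuousOn hc).bddAbove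
  exact ⟨r, fun y hy => hr (mem_image_of_mem _ hy)⟩

/-- **Arzelà-Ascoli** for curves that are `1`-Lipschitz for `k_D`. -/
theorem exists_subseq_tendstoUniformlyOn (H : IsProperGeodesic D) {o : CSpace n} (ho : o ∈ D)
    {f : ℕ → ℝ → CSpace n} {R : ℝ} (hfD : ∀ k t, f k t ∈ D)
    (hf : ∀ k s t, kobayashiDist D (f k s) (f k t) ≤ |s - t|)
    (h0 : ∀ k, kobayashiDist D o (f k 0) ≤ R) :
    ∃ φ : ℕ → ℕ, StrictMono φ ∧ ∃ g : ℝ → CSpace n, (∀ t, g t ∈ D) ∧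
      ∀ T : ℝ, TendstoUniformlyOn (fun j => f (φ j)) g atTop (Icc (-T) T) := by
  obtain ⟨C, hC, hnorm⟩ := H.exists_norm_le
  have hball : ∀ k t, f k t ∈ {y | y ∈ D ∧ kobayashiDist D o y ≤ R + |t|} := fun k t => by
    refine ⟨hfD k t, (H.triangle ho (hfD k 0) (hfD k t)).trans (add_le_add (h0 k) ?_)⟩
    simpa using hf k 0 t
  have hlip : ∀ k s t, dist (f k s) (f k t) ≤ C * |s - t| := fun k s t => by
    rw [dist_eq_norm]
    exact (hnorm _ (hfD k s) _ (hfD k t)).trans (mul_le_mul_of_nonneg_left (hf k s t) hC.le)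
  -- Compactness of the product over rational times replaces the diagonal argument. The common
  -- Euclidean Lipschitz constant `C` then extends convergence to real times and makes it uniform on
  -- compacta.
  obtain ⟨g₀, -, φ, hφ, hlim⟩ := (isCompact_univ_pi fun q : ℚ =>
    H.isCompact_closedBall o ho (R + |(q : ℝ)|)).tendsto_subseq
      (x := fun k (q : ℚ) => f k q) fun k q _ => hball k q
  have hlim' : ∀ q : ℚ, Tendsto (fun j => f (φ j) q) atTop (𝓝 (g₀ q)) := fun q =>
    (tendsto_pi_nhds.1 hlim) q
  have hcauchy : ∀ t : ℝ, CauchySeq fun j => f (φ j) t := by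
    intro t
    refine Metric.cauchySeq_iff.2 fun ε hε => ?_
    obtain ⟨q, hq1, hq2⟩ := exists_rat_btwn (show t < t + ε / (4 * C) by
      have : 0 < ε / (4 * C) := by positivity
      linarith)
    obtain ⟨N, hN⟩ := Metric.cauchySeq_iff.1 (hlim' q).cauchySeq (ε / 4) (by positivity)
    refine ⟨N, fun i hi j hj => ?_⟩
    have hqt : C * |t - q| ≤ ε / 4 := by
      rw [abs_of_neg (by linarith)]
      have : (q : ℝ) - t ≤ ε / (4 * C) := by linarith
      calc C * -(t - q) = C * (q - t) := by ring
        _ ≤ C * (ε / (4 * C)) := mul_le_mul_of_nonneg_left this hC.le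
        _ = ε / 4 := by field_simp
    have h1 := (hlip (φ i) t q).trans hqt
    have h2 := (hlip (φ j) t q).trans hqt
    rw [dist_comm] at h2
    have h3 := hN i hi j hj
    have := dist_triangle4 (f (φ i) t) (f (φ i) q) (f (φ j) q) (f (φ j) t)
    linarith
  choose g hg using fun t => cauchySeq_tendsto_of_complete (hcauchy t)
  have hglip : ∀ s t, dist (g s) (g t) ≤ C * |s - t| := fun s t =>
    le_of_tendsto ((hg s).dist (hg t)) (Eventually.of_forall fun j => hlip (φ j) s t)
  refine ⟨φ, hφ, g, fun t => ?_, fun T => ?_⟩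
  · exact ((H.isCompact_closedBall o ho (R + |t|)).isClosed.mem_of_tendsto (hg t)
      (Eventually.of_forall fun j => hball (φ j) t)).1
  · rw [← tendstoLocallyUniformlyOn_iff_tendstoUniformlyOn_of_compact isCompact_Icc]
    refine Metric.tendstoLocallyUniformlyOn_iff.2 fun ε hε x _ => ?_
    refine ⟨Metric.ball x (ε / (4 * C)),
      mem_nhdsWithin_of_mem_nhds (Metric.ball_mem_nhds x (by positivity)), ?_⟩
    filter_upwards [Metric.tendsto_nhds.1 (hg x) (ε / 4) (by positivity)] with j hj y hy
    have hxy : C * |y - x| ≤ ε / 4 := by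
      rw [Metric.mem_ball, Real.dist_eq] at hy
      calc C * |y - x| ≤ C * (ε / (4 * C)) := mul_le_mul_of_nonneg_left hy.le hC.le
        _ = ε / 4 := by field_simp
    have h1 := (hglip y x).trans hxy
    have h2 := (hlip (φ j) y x).trans hxy
    rw [dist_comm] at h2 hj
    have := dist_triangle4 (g y) (g x) (f (φ j) x) (f (φ j) y)
    linarith

lemma isGeodesicOn_of_tendsto (H : IsProperGeodesic D) {I : Set ℝ} {f : ℕ → ℝ → CSpace n}
    {g : ℝ → CSpace n} (hgD : ∀ t ∈ I, g t ∈ D)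
    (hg : ∀ t ∈ I, Tendsto (fun j => f j t) atTop (𝓝 (g t)))
    (hf : ∀ s ∈ I, ∀ t ∈ I, ∀ᶠ j in atTop, kobayashiDist D (f j s) (f j t) = |s - t|) :
    IsGeodesicOn D I g :=
  ⟨hgD, fun s hs t ht => tendsto_nhds_unique
    (H.tendsto_kobayashiDist (hg s hs) (hg t ht) (hgD s hs) (hgD t ht))
    (tendsto_const_nhds.congr' ((hf s hs t ht).mono fun _ h => h.symm))⟩

/-- Arzelà-Ascoli for geodesics whose domains of definition vary. -/
theorem exists_subseq_of_isGeodesicOn (H : IsProperGeodesic D) {o : CSpace n} (ho : o ∈ D)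
    {σ : ℕ → ℝ → CSpace n} {a b : ℕ → ℝ} {R : ℝ} (ha : ∀ k, a k ≤ 0) (hb : ∀ k, 0 ≤ b k)
    (hσ : ∀ k, IsGeodesicOn D (Icc (a k) (b k)) (σ k)) (h0 : ∀ k, kobayashiDist D o (σ k 0) ≤ R) :
    ∃ φ : ℕ → ℕ, StrictMono φ ∧ ∃ g : ℝ → CSpace n, (∀ t, g t ∈ D) ∧
      ∀ c d : ℝ, (∀ᶠ j in atTop, a (φ j) ≤ c ∧ d ≤ b (φ j)) →
        TendstoUniformlyOn (fun j => σ (φ j)) g atTop (Icc c d) := by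
  have hab : ∀ k, a k ≤ b k := fun k => (ha k).trans (hb k)
  -- Clamping the time to `[a k, b k]` extends each geodesic to a `1`-Lipschitz curve on the whole
  -- line.
  obtain ⟨φ, hφ, g, hgD, hg⟩ := H.exists_subseq_tendstoUniformlyOn ho
    (f := fun k t => σ k (projIcc (a k) (b k) (hab k) t)) (R := R)
    (fun k t => (hσ k).1 (projIcc _ _ (hab k) t).2)
    (fun k s t => by
      rw [(hσ k).2 _ (projIcc _ _ (hab k) s).2 _ (projIcc _ _ (hab k) t).2]
      exact abs_projIcc_sub_projIcc (hab k))
    (fun k => by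
      rw [projIcc_of_mem (hab k) ⟨ha k, hb k⟩]
      exact h0 k)
  refine ⟨φ, hφ, g, hgD, fun c d hcd => ?_⟩
  have h1 := (hg (max |c| |d|)).mono (s' := Icc c d) fun t ht =>
    ⟨by linarith [le_max_left |c| |d|, neg_abs_le c, ht.1],
      by linarith [le_max_right |c| |d|, le_abs_self d, ht.2]⟩
  refine h1.congr ?_
  filter_upwards [hcd] with j hj t ht
  simp only
  rw [projIcc_of_mem (hab (φ j)) ⟨hj.1.trans ht.1, ht.2.trans hj.2⟩]

theorem exists_subseq_ray (H : IsProperGeodesic D) {z₀ : D} {γ : ℕ → ℝ → CSpace n} {R : ℕ → ℝ}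
    (hR0 : ∀ k, 0 ≤ R k) (hR : Tendsto R atTop atTop)
    (hγ : ∀ k, IsGeodesicOn D (Icc 0 (R k)) (γ k)) (h0 : ∀ k, γ k 0 = z₀) :
    ∃ φ : ℕ → ℕ, StrictMono φ ∧ ∃ η : GeodesicRay D z₀,
      ∀ T : ℝ, TendstoUniformlyOn (fun j => γ (φ j)) η.1 atTop (Icc 0 T) := by
  obtain ⟨φ, hφ, g, hgD, hg⟩ := H.exists_subseq_of_isGeodesicOn z₀.2 (a := fun _ => 0) (R := 0)
    (fun _ => le_rfl) hR0 hγ fun k => by rw [h0, kobayashiDist_self z₀.2]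
  have hunif : ∀ T : ℝ, TendstoUniformlyOn (fun j => γ (φ j)) g atTop (Icc 0 T) := fun T =>
    hg 0 T (((hR.comp hφ.tendsto_atTop).eventually_ge_atTop T).mono fun j hj => ⟨le_rfl, hj⟩)
  have hpt : ∀ t ∈ Ici (0 : ℝ), Tendsto (fun j => γ (φ j) t) atTop (𝓝 (g t)) := fun t ht =>
    (hunif t).tendsto_at ⟨ht, le_rfl⟩
  refine ⟨φ, hφ, ⟨g, H.isGeodesicOn_of_tendsto (fun t _ => hgD t) hpt fun s hs t ht => ?_, ?_⟩,
    hunif⟩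
  · filter_upwards [(hR.comp hφ.tendsto_atTop).eventually_ge_atTop (max s t)] with j hj
    exact (hγ (φ j)).2 s ⟨hs, (le_max_left _ _).trans hj⟩ t ⟨ht, (le_max_right _ _).trans hj⟩
  · refine tendsto_nhds_unique (hpt 0 (mem_Ici.2 le_rfl)) ?_
    simp only [h0]
    exact tendsto_const_nhds

end IsProperGeodesic

end Limits

/-! ### Slim triangles, equivalence of rays, convergence to ideal points. -/

section GromovHyperbolic

variable {n : ℕ} {D : Set (CSpace n)}

/-- All geodesic triangles of `(D, k_D)` are `δ`-slim. -/
def HasSlimTriangles (D : Set (CSpace n)) (δ : ℝ) : Prop :=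
  ∀ (x y z : CSpace n) (L₁ L₂ L₃ : ℝ) (σ₁ σ₂ σ₃ : ℝ → CSpace n),
    IsGeodesicJoining D x y L₁ σ₁ → IsGeodesicJoining D y z L₂ σ₂ →
    IsGeodesicJoining D z x L₃ σ₃ → ∀ s ∈ Icc 0 L₁,
      (∃ t ∈ Icc 0 L₂, kobayashiDist D (σ₁ s) (σ₂ t) ≤ δ) ∨
      (∃ t ∈ Icc 0 L₃, kobayashiDist D (σ₁ s) (σ₃ t) ≤ δ)

lemma isGeodesicJoining_const {x : CSpace n} (hx : x ∈ D) :
    IsGeodesicJoining D x x 0 fun _ => x := by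
  refine ⟨le_rfl, ⟨fun _ _ => hx, fun s hs t ht => ?_⟩, rfl, rfl⟩
  rw [kobayashiDist_self hx, le_antisymm hs.2 hs.1, le_antisymm ht.2 ht.1, sub_zero, abs_zero]

lemma HasSlimTriangles.nonneg {δ : ℝ} (hδ : HasSlimTriangles D δ) {x : CSpace n} (hx : x ∈ D) :
    0 ≤ δ := by
  have h := isGeodesicJoining_const hx
  rcases hδ x x x 0 0 0 _ _ _ h h h 0 ⟨le_rfl, le_rfl⟩ with ⟨t, -, ht⟩ | ⟨t, -, ht⟩ <;>
    exact (kobayashiDist_nonneg D _ _).trans ht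

namespace IsGeodesicJoining

variable {x y : CSpace n} {L : ℝ} {σ : ℝ → CSpace n}

lemma mem (h : IsGeodesicJoining D x y L σ) {t : ℝ} (ht : t ∈ Icc 0 L) : σ t ∈ D := h.2.1.1 ht

lemma dist_left (h : IsGeodesicJoining D x y L σ) {t : ℝ} (ht : t ∈ Icc 0 L) :
    kobayashiDist D x (σ t) = t := by
  have := h.2.1.2 0 ⟨le_rfl, h.1⟩ t ht
  rwa [h.2.2.1, zero_sub, abs_neg, abs_of_nonneg ht.1] at this

lemma dist_right (h : IsGeodesicJoining D x y L σ) {t : ℝ} (ht : t ∈ Icc 0 L) :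
    kobayashiDist D (σ t) y = L - t := by
  have := h.2.1.2 t ht L ⟨h.1, le_rfl⟩
  rwa [h.2.2.2, abs_of_nonpos (by linarith [ht.2]), neg_sub] at this

lemma length_eq (h : IsGeodesicJoining D x y L σ) : kobayashiDist D x y = L := by
  have := h.dist_left (t := L) ⟨h.1, le_rfl⟩
  rwa [h.2.2.2] at this

lemma left_mem (h : IsGeodesicJoining D x y L σ) : x ∈ D := by
  rw [← h.2.2.1]; exact h.mem ⟨le_rfl, h.1⟩

lemma right_mem (h : IsGeodesicJoining D x y L σ) : y ∈ D := by
  rw [← h.2.2.2]; exact h.mem ⟨h.1, le_rfl⟩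

lemma reverse (h : IsGeodesicJoining D x y L σ) :
    IsGeodesicJoining D y x L fun t => σ (L - t) := by
  have hm : ∀ t ∈ Icc 0 L, L - t ∈ Icc 0 L := fun t ht =>
    ⟨by linarith [ht.2], by linarith [ht.1]⟩
  refine ⟨h.1, ⟨fun t ht => h.mem (hm t ht), fun s hs t ht => ?_⟩, by simp [h.2.2.2],
    by simp [h.2.2.1]⟩
  rw [h.2.1.2 _ (hm s hs) _ (hm t ht), sub_sub_sub_cancel_left, abs_sub_comm]

end IsGeodesicJoining

/-- Two geodesics issuing from `o` stay close to each other as long as they are far closer to `o`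
than a geodesic which joins their end points. -/
theorem HasSlimTriangles.dist_le_two_mul (H : IsProperGeodesic D) {δ : ℝ}
    (hδ : HasSlimTriangles D δ) {o x y : CSpace n} {a b L r t : ℝ} {α β σ : ℝ → CSpace n}
    (hα : IsGeodesicJoining D o x a α) (hβ : IsGeodesicJoining D o y b β)
    (hσ : IsGeodesicJoining D x y L σ) (hr : ∀ s ∈ Icc 0 L, r + δ < kobayashiDist D o (σ s))
    (ht : t ∈ Icc 0 r) : kobayashiDist D (α t) (β t) ≤ 2 * δ := by
  have hδ0 := hδ.nonneg hα.left_mem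
  have ha := hr 0 ⟨le_rfl, hσ.1⟩
  have hb := hr L ⟨hσ.1, le_rfl⟩
  rw [hσ.2.2.1, hα.length_eq] at ha
  rw [hσ.2.2.2, hβ.length_eq] at hb
  have hta : t ∈ Icc 0 a := ⟨ht.1, by linarith [ht.2]⟩
  have htb : t ∈ Icc 0 b := ⟨ht.1, by linarith [ht.2]⟩
  -- A point of the side `α` close to `σ` would bring `σ` within `r + δ` of `o`. So it is close to
  -- `β` at some time `b - u`, and comparing distances to `o` gives `|b - u - t| ≤ δ`.
  rcases hδ _ _ _ _ _ _ _ _ _ hα hσ hβ.reverse t hta with ⟨s, hs, h⟩ | ⟨u, hu, h⟩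
  · have h1 := H.triangle hα.left_mem (hα.mem hta) (hσ.mem hs)
    rw [hα.dist_left hta] at h1
    linarith [hr s hs, ht.2]
  · have hu' : b - u ∈ Icc 0 b := ⟨by linarith [hu.2], by linarith [hu.1]⟩
    have h1 := H.triangle hα.left_mem (hα.mem hta) (hβ.mem hu')
    have h2 := H.triangle hα.left_mem (hβ.mem hu') (hα.mem hta)
    have h3 := H.triangle (hα.mem hta) (hβ.mem hu') (hβ.mem htb)
    rw [hα.dist_left hta, hβ.dist_left hu'] at h1 h2
    rw [kobayashiDist_comm D (β (b - u)) (α t)] at h2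
    rw [hβ.2.1.2 _ hu' _ htb] at h3
    have h4 : |b - u - t| ≤ δ := abs_le.2 ⟨by linarith, by linarith⟩
    linarith

namespace GeodesicRay

variable {z₀ : D}

lemma mem (γ : GeodesicRay D z₀) {t : ℝ} (ht : 0 ≤ t) : γ.1 t ∈ D := γ.2.1.1 ht

lemma isGeodesicJoining (γ : GeodesicRay D z₀) {t : ℝ} (ht : 0 ≤ t) :
    IsGeodesicJoining D z₀ (γ.1 t) t γ.1 :=
  ⟨ht, ⟨fun _ hs => γ.mem hs.1, fun s hs u hu => γ.2.1.2 s hs.1 u hu.1⟩, γ.2.2, rfl⟩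

lemma dist_base (γ : GeodesicRay D z₀) {t : ℝ} (ht : 0 ≤ t) : kobayashiDist D z₀ (γ.1 t) = t :=
  (γ.isGeodesicJoining ht).length_eq

lemma equiv_iff (H : IsProperGeodesic D) {γ η : GeodesicRay D z₀} :
    γ ≈ η ↔ ∃ M : ℝ, ∀ t : ℝ, 0 ≤ t → kobayashiDist D (γ.1 t) (η.1 t) ≤ M := by
  change (⨆ t ∈ Ici (0 : ℝ), kobayashiEDist D (γ.1 t) (η.1 t)) < ⊤ ↔ _
  constructor
  · intro h
    refine ⟨(⨆ t ∈ Ici (0 : ℝ), kobayashiEDist D (γ.1 t) (η.1 t)).toReal, fun t ht => ?_⟩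
    exact ENNReal.toReal_mono h.ne
      (le_iSup₂ (f := fun t (_ : t ∈ Ici (0 : ℝ)) => kobayashiEDist D (γ.1 t) (η.1 t)) t ht)
  · rintro ⟨M, hM⟩
    refine lt_of_le_of_lt (b := ENNReal.ofReal M) (iSup₂_le fun t ht => ?_) ENNReal.ofReal_lt_top
    rw [← ENNReal.ofReal_toReal (H.ne_top _ (γ.mem ht) _ (η.mem ht))]
    exact ENNReal.ofReal_le_ofReal (hM t ht)

/-- Equivalent rays are uniformly close to each other. -/
theorem dist_le_of_equiv (H : IsProperGeodesic D) {δ : ℝ} (hδ : HasSlimTriangles D δ)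
    {γ η : GeodesicRay D z₀} (h : γ ≈ η) {t : ℝ} (ht : 0 ≤ t) :
    kobayashiDist D (γ.1 t) (η.1 t) ≤ 2 * δ := by
  obtain ⟨M, hM⟩ := (equiv_iff H).1 h
  have hδ0 := hδ.nonneg z₀.2
  have hM0 : 0 ≤ M := (kobayashiDist_nonneg D _ _).trans (hM 0 le_rfl)
  -- At this time the rays are at most `M` apart, so a geodesic joining them stays at distance at
  -- least `t + δ + 1` from `z₀`.
  have hT : 0 ≤ t + M + δ + 1 := by positivity
  obtain ⟨σ, hσ⟩ := H.exists_geodesic _ (γ.mem hT) _ (η.mem hT)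
  refine hδ.dist_le_two_mul H (γ.isGeodesicJoining hT) (η.isGeodesicJoining hT) hσ (r := t)
    (fun s hs => ?_) ⟨ht, le_rfl⟩
  have h1 := H.triangle z₀.2 (hσ.mem hs) (γ.mem hT)
  rw [γ.dist_base hT, kobayashiDist_comm D (σ s), hσ.dist_left hs] at h1
  linarith [hs.2, hM _ hT]

lemma equiv_of_tendsto (H : IsProperGeodesic D) {α β : ℕ → ℝ → CSpace n} {η η' : GeodesicRay D z₀}
    {M : ℝ} (hα : ∀ T : ℝ, TendstoUniformlyOn α η.1 atTop (Icc 0 T))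
    (hβ : ∀ T : ℝ, TendstoUniformlyOn β η'.1 atTop (Icc 0 T))
    (h : ∀ t : ℝ, 0 ≤ t → ∀ᶠ j in atTop, kobayashiDist D (α j t) (β j t) ≤ M) : η ≈ η' :=
  (equiv_iff H).2 ⟨M, fun t ht => le_of_tendsto (H.tendsto_kobayashiDist
    ((hα t).tendsto_at ⟨ht, le_rfl⟩) ((hβ t).tendsto_at ⟨ht, le_rfl⟩) (η.mem ht) (η'.mem ht))
    (h t ht)⟩

end GeodesicRay

lemma TendstoUniformlyOn.comp_strictMono {α : ℕ → ℝ → CSpace n} {g : ℝ → CSpace n} {S : Set ℝ}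
    (h : TendstoUniformlyOn α g atTop S) {ψ : ℕ → ℕ} (hψ : StrictMono ψ) :
    TendstoUniformlyOn (fun j => α (ψ j)) g atTop S := fun u hu =>
  hψ.tendsto_atTop.eventually (h u hu)

/-! ### Convergence in the Gromov compactification. -/

section Convergence

variable {z₀ : D}

/-- `PointsConverge` quantifies over all geodesics and all subsequences, but two geodesics from `z₀`
to the same point are `2δ`-close on bounded time intervals once they are long. So one convergent
choice suffices. -/
theorem pointsConverge_of_tendsto (H : IsProperGeodesic D) {δ : ℝ} (hδ : HasSlimTriangles D δ)
    {z : ℕ → D} {R : ℕ → ℝ} {α : ℕ → ℝ → CSpace n}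
    (hα : ∀ k, IsGeodesicJoining D z₀ (z k) (R k) (α k)) (hR : Tendsto R atTop atTop)
    {η : GeodesicRay D z₀} (h : ∀ T : ℝ, TendstoUniformlyOn α η.1 atTop (Icc 0 T)) :
    PointsConverge z (Quotient.mk (geodesicRaySetoid D z₀) η) := by
  intro R' γ hγ φ hφ
  obtain rfl : R' = R := funext fun k => (hγ k).length_eq.symm.trans (hα k).length_eq
  have hRφ := hR.comp hφ.tendsto_atTop
  obtain ⟨ψ, hψ, η', hη'⟩ := H.exists_subseq_ray (R := fun k => R' (φ k))
    (fun k => (hγ (φ k)).1) hRφ (fun k => (hγ (φ k)).2.1) (fun k => (hγ (φ k)).2.2.1)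
  refine ⟨ψ, hψ, hRφ.comp hψ.tendsto_atTop, η', Quotient.sound ?_, hη'⟩
  refine GeodesicRay.equiv_of_tendsto H (M := 2 * δ) hη'
    (fun T => ((h T).comp_strictMono hφ).comp_strictMono hψ) fun t ht => ?_
  filter_upwards [(hRφ.comp hψ.tendsto_atTop).eventually_gt_atTop (t + δ)] with j hj
  have hg := hγ (φ (ψ j))
  -- Slimness is applied to a degenerate triangle whose side opposite to `z₀` is constant.
  refine hδ.dist_le_two_mul H hg (hα (φ (ψ j))) (isGeodesicJoining_const hg.right_mem) (r := t)
    (fun s _ => ?_) ⟨ht, le_rfl⟩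
  rw [hg.length_eq]
  exact hj

/-- Here the independence of the representatives comes from the uniform bound
`GeodesicRay.dist_le_of_equiv`. -/
theorem classesConverge_of_tendsto (H : IsProperGeodesic D) {δ : ℝ} (hδ : HasSlimTriangles D δ)
    {α : ℕ → GeodesicRay D z₀} {η : GeodesicRay D z₀}
    (h : ∀ T : ℝ, TendstoUniformlyOn (fun k => (α k).1) η.1 atTop (Icc 0 T)) :
    ClassesConverge (fun k => Quotient.mk (geodesicRaySetoid D z₀) (α k))
      (Quotient.mk (geodesicRaySetoid D z₀) η) := by
  intro γ hγ φ hφ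
  obtain ⟨ψ, hψ, η', hη'⟩ := H.exists_subseq_ray (R := fun k => (k : ℝ))
    (γ := fun k => (γ (φ k)).1) (fun k => k.cast_nonneg) tendsto_natCast_atTop_atTop
    (fun k => ((γ (φ k)).isGeodesicJoining k.cast_nonneg).2.1) (fun k => (γ (φ k)).2.2)
  refine ⟨ψ, hψ, η', Quotient.sound ?_, hη'⟩
  refine GeodesicRay.equiv_of_tendsto H (M := 2 * δ) hη'
    (fun T => ((h T).comp_strictMono hφ).comp_strictMono hψ) fun t ht => ?_
  exact Eventually.of_forall fun j =>
    GeodesicRay.dist_le_of_equiv H hδ (Quotient.exact (hγ (φ (ψ j)))) ht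

/-- Together with `exists_subseq_classesConverge`, this is the sequential compactness of the Gromov
compactification at infinity. -/
theorem exists_subseq_pointsConverge (H : IsProperGeodesic D) {δ : ℝ} (hδ : HasSlimTriangles D δ)
    {z : ℕ → D} (hz : Tendsto (fun k => kobayashiDist D z₀ (z k)) atTop atTop) :
    ∃ φ : ℕ → ℕ, StrictMono φ ∧ ∃ σ : GromovBoundary D z₀,
      PointsConverge (fun j => z (φ j)) σ := by
  choose α hα using fun k => H.exists_geodesic z₀ z₀.2 (z k) (z k).2
  obtain ⟨φ, hφ, η, hη⟩ := H.exists_subseq_ray (fun k => (hα k).1) hz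
    (fun k => (hα k).2.1) (fun k => (hα k).2.2.1)
  exact ⟨φ, hφ, _, pointsConverge_of_tendsto H hδ (fun k => hα (φ k))
    (hz.comp hφ.tendsto_atTop) hη⟩

theorem exists_subseq_classesConverge (H : IsProperGeodesic D) {δ : ℝ}
    (hδ : HasSlimTriangles D δ) (s : ℕ → GromovBoundary D z₀) :
    ∃ φ : ℕ → ℕ, StrictMono φ ∧ ∃ σ : GromovBoundary D z₀,
      ClassesConverge (fun j => s (φ j)) σ := by
  choose α hα using fun k => Quotient.exists_rep (s k)
  obtain ⟨φ, hφ, η, hη⟩ := H.exists_subseq_ray (R := fun k => (k : ℝ))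
    (γ := fun k => (α k).1) (fun k => k.cast_nonneg) tendsto_natCast_atTop_atTop
    (fun k => ((α k).isGeodesicJoining k.cast_nonneg).2.1) (fun k => (α k).2.2)
  refine ⟨φ, hφ, Quotient.mk _ η, ?_⟩
  simpa only [hα] using classesConverge_of_tendsto H hδ (α := fun j => α (φ j)) hη

/-- If the geodesics which join `x k` and `y k` leave every ball, then `x` and `y` have
subsequences with the same limit in the Gromov boundary. -/
theorem exists_subseq_pointsConverge_pair (H : IsProperGeodesic D) {δ : ℝ}
    (hδ : HasSlimTriangles D δ) {x y : ℕ → D} {L : ℕ → ℝ} {σ : ℕ → ℝ → CSpace n}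
    (hσ : ∀ k, IsGeodesicJoining D (x k) (y k) (L k) (σ k))
    (hfar : ∀ (k : ℕ), ∀ s ∈ Icc 0 (L k), (k : ℝ) ≤ kobayashiDist D z₀ (σ k s)) :
    ∃ φ : ℕ → ℕ, StrictMono φ ∧ ∃ τ : GromovBoundary D z₀,
      PointsConverge (fun j => x (φ j)) τ ∧ PointsConverge (fun j => y (φ j)) τ := by
  have hx : Tendsto (fun k => kobayashiDist D z₀ (x k)) atTop atTop :=
    tendsto_atTop_mono (fun k => by
      have := hfar k 0 ⟨le_rfl, (hσ k).1⟩
      rwa [(hσ k).2.2.1] at this) tendsto_natCast_atTop_atTop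
  have hy : Tendsto (fun k => kobayashiDist D z₀ (y k)) atTop atTop :=
    tendsto_atTop_mono (fun k => by
      have := hfar k (L k) ⟨(hσ k).1, le_rfl⟩
      rwa [(hσ k).2.2.2] at this) tendsto_natCast_atTop_atTop
  choose α hα using fun k => H.exists_geodesic z₀ z₀.2 (x k) (x k).2
  choose β hβ using fun k => H.exists_geodesic z₀ z₀.2 (y k) (y k).2
  obtain ⟨φ, hφ, η, hη⟩ := H.exists_subseq_ray (fun k => (hα k).1) hx
    (fun k => (hα k).2.1) (fun k => (hα k).2.2.1)
  obtain ⟨ψ, hψ, η', hη'⟩ := H.exists_subseq_ray (fun k => (hβ (φ k)).1)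
    (hy.comp hφ.tendsto_atTop) (fun k => (hβ (φ k)).2.1) (fun k => (hβ (φ k)).2.2.1)
  have hηψ := fun T => (hη T).comp_strictMono hψ
  have hφψ := hφ.comp hψ
  have heq : η ≈ η' := by
    refine GeodesicRay.equiv_of_tendsto H (M := 2 * δ) hηψ hη' fun t ht => ?_
    filter_upwards [(tendsto_natCast_atTop_atTop.comp hφψ.tendsto_atTop).eventually_gt_atTop
      (t + δ)] with j hj
    exact hδ.dist_le_two_mul H (hα _) (hβ _) (hσ _) (r := t)
      (fun s hs => lt_of_lt_of_le hj (hfar _ s hs)) ⟨ht, le_rfl⟩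
  refine ⟨fun j => φ (ψ j), hφψ, Quotient.mk _ η, ?_, ?_⟩
  · exact pointsConverge_of_tendsto H hδ (fun k => hα (φ (ψ k))) (hx.comp hφψ.tendsto_atTop) hηψ
  · rw [Quotient.sound heq]
    exact pointsConverge_of_tendsto H hδ (fun k => hβ (φ (ψ k))) (hy.comp hφψ.tendsto_atTop) hη'

/-- Immediate from the definition of the open sets. Only this implication is needed; topological
convergence need not be decoded. -/
lemma PointsConverge.tendsto {z : ℕ → D} {σ : GromovBoundary D z₀} (h : PointsConverge z σ) :
    Tendsto (fun k => GromovCompactification.inner (z₀ := z₀) (z k)) atTop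
      (𝓝 (GromovCompactification.ideal σ)) :=
  tendsto_nhds.2 fun _ hW hσ => ((hW.2 σ hσ).1 z h)

lemma ClassesConverge.tendsto {s : ℕ → GromovBoundary D z₀} {σ : GromovBoundary D z₀}
    (h : ClassesConverge s σ) :
    Tendsto (fun k => GromovCompactification.ideal (s k)) atTop
      (𝓝 (GromovCompactification.ideal σ)) :=
  tendsto_nhds.2 fun _ hW hσ => ((hW.2 σ hσ).2 s h)

end Convergence

end GromovHyperbolic

/-! ### Visibility and the continuous extension. -/

section Visibility

variable {n : ℕ} {D : Set (CSpace n)} {z₀ : D}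

lemma IsGeodesicOn.shift {σ : ℝ → CSpace n} {a b c d s : ℝ} (h : IsGeodesicOn D (Icc a b) σ)
    (hc : a ≤ s + c) (hd : s + d ≤ b) : IsGeodesicOn D (Icc c d) fun t => σ (s + t) := by
  have hm : ∀ t ∈ Icc c d, s + t ∈ Icc a b := fun t ht =>
    ⟨by linarith [ht.1], by linarith [ht.2]⟩
  refine ⟨fun t ht => h.1 (hm t ht), fun t ht u hu => ?_⟩
  rw [h.2 _ (hm t ht) _ (hm u hu), add_sub_add_left_eq_sub]

lemma IsGeodesicOn.comp_neg {σ : ℝ → CSpace n} {I J : Set ℝ} (h : IsGeodesicOn D I σ)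
    (hJ : ∀ t ∈ J, -t ∈ I) : IsGeodesicOn D J fun t => σ (-t) := by
  refine ⟨fun t ht => h.1 (hJ t ht), fun t ht u hu => ?_⟩
  rw [h.2 _ (hJ t ht) _ (hJ u hu), neg_sub_neg, abs_sub_comm]

lemma IsGeodesicOn.mono {σ : ℝ → CSpace n} {I J : Set ℝ} (h : IsGeodesicOn D I σ) (hJ : J ⊆ I) :
    IsGeodesicOn D J σ :=
  ⟨h.1.mono_left hJ, fun s hs t ht => h.2 s (hJ hs) t (hJ ht)⟩

namespace IsProperGeodesic

lemma mem_frontier (H : IsProperGeodesic D) {p : CSpace n} (hp : p ∈ closure D) (hp' : p ∉ D) :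
    p ∈ frontier D := by
  rw [H.isOpen.frontier_eq]; exact ⟨hp, hp'⟩

lemma isCompact_closure (H : IsProperGeodesic D) : IsCompact (closure D) :=
  H.isBounded.isCompact_closure

/-- In a visible domain, two boundary points which are arbitrarily close to the end points of
geodesics far from the base point are equal. -/
lemma eq_of_far_geodesics (H : IsProperGeodesic D) (hv : HasVisibilityProperty D) {o p q : CSpace n}
    (ho : o ∈ D) (hp : p ∈ frontier D) (hq : q ∈ frontier D)
    (h : ∀ U ∈ 𝓝 p, ∀ V ∈ 𝓝 q, ∀ r : ℝ, ∃ (a b : ℝ) (γ : ℝ → CSpace n), a ≤ b ∧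
      IsGeodesicOn D (Icc a b) γ ∧ γ a ∈ U ∧ γ b ∈ V ∧
      ∀ s ∈ Icc a b, r < kobayashiDist D o (γ s)) : p = q := by
  by_contra hpq
  obtain ⟨U, hU, V, hV, -, K, hK, hKD, hvis⟩ := hv p hp q hq hpq
  obtain ⟨r, hr⟩ := H.exists_dist_le_of_isCompact hK hKD ho
  obtain ⟨a, b, γ, hab, hγ, ha, hb, hfar⟩ := h U hU V hV r
  obtain ⟨_, ⟨t, ht, rfl⟩, htK⟩ := hvis (b - a) (fun t => γ (a + t)) (sub_nonneg.2 hab)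
    (hγ.shift (by simp) (by simp)) (by simpa using ha) (by simpa using hb)
  exact (hfar (a + t) ⟨by linarith [ht.1], by linarith [ht.2]⟩).not_ge (hr _ htK)

/-- Fix a late time `T` at which the limit curve is near `p`, then take `k` so large that `γ k T` is
near `p` as well. The piece of `γ k` from `T` to `b` ends near `q` and stays at distance at least `T
- R` from `o`, so visibility applies. Landing of rays, continuity of the extension and the ends of
limit lines all rest on this. -/
lemma eq_of_mapClusterPt (H : IsProperGeodesic D) (hv : HasVisibilityProperty D)
    {o p q : CSpace n} (ho : o ∈ D) (hp : p ∈ frontier D) (hq : q ∈ frontier D)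
    {γ : ℕ → ℝ → CSpace n} {g : ℝ → CSpace n} {R : ℝ} (h0 : ∀ k, kobayashiDist D o (γ k 0) ≤ R)
    (hg : ∀ t : ℝ, 0 ≤ t → Tendsto (fun k => γ k t) atTop (𝓝 (g t)))
    (hpg : MapClusterPt p atTop g)
    (hqg : ∀ V ∈ 𝓝 q, ∀ T : ℝ, ∀ᶠ k in atTop, ∃ b, T ≤ b ∧ IsGeodesicOn D (Icc 0 b) (γ k) ∧
      γ k b ∈ V) : p = q := by
  refine H.eq_of_far_geodesics hv ho hp hq fun U hU V hV r => ?_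
  obtain ⟨T, hTU, hT⟩ := ((hpg.frequently (interior_mem_nhds.2 hU)).and_eventually
    (eventually_gt_atTop (max 0 (r + R)))).exists
  have hT0 : 0 < T := (le_max_left _ _).trans_lt hT
  have hTr : r + R < T := (le_max_right _ _).trans_lt hT
  obtain ⟨k, hk, b, hTb, hγ, hb⟩ := (((hg T hT0.le).eventually
    (mem_interior_iff_mem_nhds.1 hTU)).and (hqg V hV T)).exists
  refine ⟨T, b, γ k, hTb, hγ.mono (Icc_subset_Icc_left hT0.le), hk, hb, fun s hs => ?_⟩
  have hs0 : 0 ≤ s := hT0.le.trans hs.1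
  have hb0 : (0 : ℝ) ∈ Icc 0 b := ⟨le_rfl, hT0.le.trans hTb⟩
  have hsb : s ∈ Icc 0 b := ⟨hs0, hs.2⟩
  have h1 := H.triangle (hγ.1 hb0) ho (hγ.1 hsb)
  rw [hγ.2 _ hb0 _ hsb, zero_sub, abs_neg, abs_of_nonneg hs0, kobayashiDist_comm] at h1
  linarith [h0 k, hs.1]

lemma tendsto_dist_of_ray (H : IsProperGeodesic D) {o : CSpace n} (ho : o ∈ D) {g : ℝ → CSpace n}
    (hg : IsGeodesicOn D (Ici 0) g) : Tendsto (fun t => kobayashiDist D o (g t)) atTop atTop := by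
  have h0 : (0 : ℝ) ∈ Ici (0 : ℝ) := mem_Ici.2 le_rfl
  refine tendsto_atTop_mono' _ ?_ (tendsto_atTop_add_const_right _ (-kobayashiDist D o (g 0))
    tendsto_id)
  filter_upwards [eventually_ge_atTop 0] with t ht
  have h1 := H.triangle (hg.1 h0) ho (hg.1 ht)
  rw [hg.2 _ h0 _ ht, zero_sub, abs_neg, abs_of_nonneg ht, kobayashiDist_comm] at h1
  simp only [id]
  linarith

/-- In a visible domain every geodesic ray lands at a boundary point. -/
theorem exists_tendsto_of_ray (H : IsProperGeodesic D) (hv : HasVisibilityProperty D)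
    {g : ℝ → CSpace n} (hg : IsGeodesicOn D (Ici 0) g) :
    ∃ p ∈ frontier D, Tendsto g atTop (𝓝 p) := by
  have h0 : g 0 ∈ D := hg.1 (mem_Ici.2 le_rfl)
  have hD : ∀ᶠ t in atTop, g t ∈ D := (eventually_ge_atTop 0).mono fun t ht => hg.1 ht
  have hcl : ∀ᶠ t in atTop, g t ∈ closure D := hD.mono fun t ht => subset_closure ht
  have hfr : ∀ p ∈ closure D, MapClusterPt p atTop g → p ∈ frontier D := fun p hp hpg => by
    obtain ⟨𝒰, h𝒰, hlim⟩ := mapClusterPt_iff_ultrafilter.1 hpg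
    exact H.mem_frontier hp (H.notMem_of_tendsto h0 hlim
      ((H.tendsto_dist_of_ray h0 hg).mono_left h𝒰))
  obtain ⟨p, hp, hpg⟩ := H.isCompact_closure.exists_mapClusterPt_of_frequently hcl.frequently
  refine ⟨p, hfr p hp hpg, H.isCompact_closure.tendsto_nhds_of_unique_mapClusterPt hcl
    fun q hq hqg => ?_⟩
  -- The constant sequence `g`: any two cluster points of the ray are compared.
  refine H.eq_of_mapClusterPt hv h0 (hfr q hq hqg) (hfr p hp hpg) (γ := fun _ => g) (R := 0)
    (fun _ => (kobayashiDist_self h0).le) (fun _ _ => tendsto_const_nhds) hqg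
    fun V hV T => Eventually.of_forall fun _ => ?_
  obtain ⟨b, hb, hTb⟩ := ((hpg.frequently hV).and_eventually (eventually_ge_atTop T)).exists
  exact ⟨b, hTb, hg.mono fun t ht => ht.1, hb⟩

/-- Geodesics joining `γ t` and `η t` have length at most `M`, hence stay at distance at least `t -
M` from `z₀`. -/
lemma eq_of_equiv (H : IsProperGeodesic D) (hv : HasVisibilityProperty D) {γ η : GeodesicRay D z₀}
    (h : γ ≈ η) {p q : CSpace n} (hp : p ∈ frontier D) (hq : q ∈ frontier D)
    (hγ : Tendsto γ.1 atTop (𝓝 p)) (hη : Tendsto η.1 atTop (𝓝 q)) : p = q := by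
  obtain ⟨M, hM⟩ := (GeodesicRay.equiv_iff H).1 h
  refine H.eq_of_far_geodesics hv z₀.2 hp hq fun U hU V hV r => ?_
  obtain ⟨t, hUt, hVt, ht⟩ := ((hγ.eventually hU).and ((hη.eventually hV).and
    (eventually_gt_atTop (max 0 (r + M))))).exists
  have ht0 : 0 ≤ t := ((le_max_left _ _).trans_lt ht).le
  have htr : r + M < t := (le_max_right _ _).trans_lt ht
  obtain ⟨σ, hσ⟩ := H.exists_geodesic _ (γ.mem ht0) _ (η.mem ht0)
  refine ⟨0, _, σ, hσ.1, hσ.2.1, by rwa [hσ.2.2.1], by rwa [hσ.2.2.2], fun s hs => ?_⟩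
  have h1 := H.triangle z₀.2 (hσ.mem hs) (γ.mem ht0)
  rw [γ.dist_base ht0, kobayashiDist_comm D (σ s), hσ.dist_left hs] at h1
  linarith [hs.2, hM t ht0]

/-- In a visible domain the points of the Gromov boundary have well defined end points in the
Euclidean boundary. -/
theorem exists_endpoint (H : IsProperGeodesic D) (hv : HasVisibilityProperty D)
    (σ : GromovBoundary D z₀) : ∃ p ∈ frontier D, ∀ η : GeodesicRay D z₀,
      Quotient.mk (geodesicRaySetoid D z₀) η = σ → Tendsto η.1 atTop (𝓝 p) := by
  obtain ⟨γ, rfl⟩ := Quotient.exists_rep σ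
  obtain ⟨p, hp, hγ⟩ := H.exists_tendsto_of_ray hv γ.2.1
  refine ⟨p, hp, fun η hη => ?_⟩
  obtain ⟨q, hq, hηq⟩ := H.exists_tendsto_of_ray hv η.2.1
  rwa [← H.eq_of_equiv hv (Quotient.exact hη) hq hp hηq hγ]

lemma tendsto_of_subseq_unique (H : IsProperGeodesic D) {u : ℕ → CSpace n} {p : CSpace n}
    (hu : ∀ k, u k ∈ closure D) (h : ∀ φ : ℕ → ℕ, StrictMono φ → ∀ q ∈ closure D,
      Tendsto (fun j => u (φ j)) atTop (𝓝 q) → q = p) : Tendsto u atTop (𝓝 p) := by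
  refine H.isCompact_closure.tendsto_nhds_of_unique_mapClusterPt (Eventually.of_forall hu)
    fun q hq hqu => ?_
  obtain ⟨φ, hφ, hlim⟩ := hqu.tendsto_subseq
  exact h φ hφ q hq hlim

/-- Along a subsequence the geodesics from `z₀` to `z k` converge to a ray landing at `p`, while
their end points tend to a cluster point `q`; visibility identifies the two. -/
lemma tendsto_of_pointsConverge (H : IsProperGeodesic D) (hv : HasVisibilityProperty D)
    {z : ℕ → D} {σ : GromovBoundary D z₀} (hz : PointsConverge z σ) {p : CSpace n}
    (hp : p ∈ frontier D) (hσ : ∀ η : GeodesicRay D z₀,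
      Quotient.mk (geodesicRaySetoid D z₀) η = σ → Tendsto η.1 atTop (𝓝 p)) :
    Tendsto (fun k => (z k : CSpace n)) atTop (𝓝 p) := by
  refine H.tendsto_of_subseq_unique (fun k => subset_closure (z k).2) fun φ hφ q hq hlim => ?_
  choose γ hγ using fun k => H.exists_geodesic z₀ z₀.2 (z k) (z k).2
  obtain ⟨ψ, hψ, hR, η, hησ, hη⟩ := hz _ γ hγ φ hφ
  have hlim' := hlim.comp hψ.tendsto_atTop
  refine (H.eq_of_mapClusterPt hv z₀.2 hp (H.mem_frontier hq (H.notMem_of_tendsto z₀.2 hlim' hR))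
    (γ := fun j => γ (φ (ψ j))) (R := 0)
    (fun k => by rw [(hγ _).2.2.1, kobayashiDist_self z₀.2])
    (fun t ht => (hη t).tendsto_at ⟨ht, le_rfl⟩) (hσ η hησ).mapClusterPt fun V hV T => ?_).symm
  filter_upwards [hR.eventually_ge_atTop T, hlim'.eventually hV] with j hj hjV
  exact ⟨_, hj, (hγ _).2.1, by rw [(hγ _).2.2.2]; exact hjV⟩

lemma tendsto_of_classesConverge (H : IsProperGeodesic D) (hv : HasVisibilityProperty D)
    {s : ℕ → GromovBoundary D z₀} {σ : GromovBoundary D z₀} (hs : ClassesConverge s σ)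
    {e : GromovBoundary D z₀ → CSpace n} (he : ∀ σ, e σ ∈ frontier D)
    (hlim : ∀ σ, ∀ η : GeodesicRay D z₀,
      Quotient.mk (geodesicRaySetoid D z₀) η = σ → Tendsto η.1 atTop (𝓝 (e σ))) :
    Tendsto (fun k => e (s k)) atTop (𝓝 (e σ)) := by
  refine H.tendsto_of_subseq_unique (fun k => frontier_subset_closure (he _))
    fun φ hφ q hq hq' => ?_
  choose γ hγ using fun k => Quotient.exists_rep (s k)
  obtain ⟨ψ, hψ, η, hησ, hη⟩ := hs γ hγ φ hφ
  have hqf : q ∈ frontier D :=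
    isClosed_frontier.mem_of_tendsto hq' (Eventually.of_forall fun _ => he _)
  refine (H.eq_of_mapClusterPt hv z₀.2 (he σ) hqf
    (γ := fun j => (γ (φ (ψ j))).1) (R := 0)
    (fun k => by rw [(γ _).2.2, kobayashiDist_self z₀.2])
    (fun t ht => (hη t).tendsto_at ⟨ht, le_rfl⟩) (hlim σ η hησ).mapClusterPt fun V hV T => ?_).symm
  -- If the landing point of the `k`-th ray is interior to `V`, the ray is in `V` at arbitrarily
  -- late times; such a time serves as `b`.
  filter_upwards [(hq'.comp hψ.tendsto_atTop).eventually (interior_mem_nhds.2 hV)] with j hj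
  obtain ⟨b, hb, hTb, hb0⟩ := (((hlim _ _ (hγ (φ (ψ j)))).eventually
    (mem_interior_iff_mem_nhds.1 hj)).and
    ((eventually_ge_atTop T).and (eventually_ge_atTop 0))).exists
  exact ⟨b, hTb, ((γ _).isGeodesicJoining hb0).2.1, hb⟩

/-- Every boundary point is the image of a point of the Gromov boundary. -/
lemma surjective_of_continuous (H : IsProperGeodesic D) {δ : ℝ} (hδ : HasSlimTriangles D δ)
    {Φ : GromovCompactification D z₀ → closure D} (hΦ : Continuous Φ)
    (hid : ∀ z : D, (Φ (GromovCompactification.inner z) : CSpace n) = z) :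
    Function.Surjective Φ := by
  rintro ⟨x, hx⟩
  by_cases hxD : x ∈ D
  · exact ⟨GromovCompactification.inner ⟨x, hxD⟩, Subtype.ext (hid _)⟩
  obtain ⟨u, huD, hu⟩ := mem_closure_iff_seq_limit.1 hx
  obtain ⟨φ, hφ, σ, hσ⟩ := exists_subseq_pointsConverge H hδ (z₀ := z₀)
    (z := fun k => ⟨u k, huD k⟩)
    (H.tendsto_atTop_of_tendsto z₀.2 hxD hu (Eventually.of_forall huD))
  refine ⟨GromovCompactification.ideal σ, Subtype.ext ?_⟩
  refine tendsto_nhds_unique ((continuous_subtype_val.comp hΦ).continuousAt.tendsto.comp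
    hσ.tendsto) ?_
  simpa only [Function.comp_def, hid] using hu.comp hφ.tendsto_atTop

/-- An ideal point is sent to the common landing point of its rays. As the topology is defined by
sequences, continuity is tested on sequences in `D` and on sequences of ideal points separately. -/
theorem exists_extension (H : IsProperGeodesic D) {δ : ℝ} (hδ : HasSlimTriangles D δ)
    (hv : HasVisibilityProperty D) :
    ∃ Φ : GromovCompactification D z₀ → closure D, IsContinuousSurjectiveExtension Φ := by
  choose e he hlim using H.exists_endpoint hv (z₀ := z₀)
  let Φ : GromovCompactification D z₀ → closure D := fun x => match x with
    | .inner z => ⟨z, subset_closure z.2⟩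
    | .ideal σ => ⟨e σ, frontier_subset_closure (he σ)⟩
  have hcont : Continuous Φ := by
    refine continuous_def.2 fun O hO => ⟨?_, fun σ hσ => ⟨fun z hz => ?_, fun s hs => ?_⟩⟩
    · exact hO.preimage (continuous_inclusion subset_closure)
    · have h : Tendsto (fun k => Φ (.inner (z k))) atTop (𝓝 (Φ (.ideal σ))) :=
        tendsto_subtype_rng.2 (H.tendsto_of_pointsConverge hv hz (he σ) (hlim σ))
      exact h.eventually (hO.mem_nhds hσ)
    · have h : Tendsto (fun k => Φ (.ideal (s k))) atTop (𝓝 (Φ (.ideal σ))) :=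
        tendsto_subtype_rng.2 (H.tendsto_of_classesConverge hv hs he hlim)
      exact h.eventually (hO.mem_nhds hσ)
  exact ⟨Φ, hcont, H.surjective_of_continuous hδ hcont fun _ => rfl, fun _ => rfl⟩

end IsProperGeodesic

namespace IsContinuousSurjectiveExtension

variable {Φ : GromovCompactification D z₀ → closure D}

lemma tendsto_points (hΦ : IsContinuousSurjectiveExtension Φ) {z : ℕ → D} {σ : GromovBoundary D z₀}
    (hz : PointsConverge z σ) : Tendsto (fun k => (z k : CSpace n)) atTop
      (𝓝 (Φ (GromovCompactification.ideal σ) : CSpace n)) := by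
  have := (continuous_subtype_val.comp hΦ.1).continuousAt.tendsto.comp hz.tendsto
  simpa only [Function.comp_def, hΦ.2.2] using this

/-- If the pair `p, q` is not visible, there are geodesics outside larger and larger balls with end
points tending to `p` and `q`. Both sequences of end points subconverge to one ideal point, so
continuity of `Φ` forces `p = q`. -/
theorem hasVisibilityProperty (hΦ : IsContinuousSurjectiveExtension Φ) (H : IsProperGeodesic D)
    {δ : ℝ} (hδ : HasSlimTriangles D δ) : HasVisibilityProperty D := by
  intro p hp q hq hpq
  by_contra hnot
  have hpos : 0 < dist p q := dist_pos.2 hpq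
  have hex : ∀ m : ℕ, ∃ (L : ℝ) (γ : ℝ → CSpace n), 0 ≤ L ∧ IsGeodesicOn D (Icc 0 L) γ ∧
      γ 0 ∈ Metric.ball p (1 / ((m : ℝ) + 1)) ∧ γ L ∈ Metric.ball q (1 / ((m : ℝ) + 1)) ∧
      ∀ s ∈ Icc 0 L, (m : ℝ) ≤ kobayashiDist D z₀ (γ s) := by
    intro m
    by_contra hcon
    push Not at hcon
    -- The bound `dist p q / 3` makes the closed balls disjoint, as the definition of visible
    -- geodesics requires.
    set r := min (1 / ((m : ℝ) + 1)) (dist p q / 3)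
    have hr : 0 < r := lt_min (by positivity) (by positivity)
    have hr1 : r ≤ 1 / ((m : ℝ) + 1) := min_le_left _ _
    have hr2 : r ≤ dist p q / 3 := min_le_right _ _
    refine hnot ⟨Metric.ball p r, Metric.ball_mem_nhds p hr, Metric.ball q r,
      Metric.ball_mem_nhds q hr, ?_, _, H.isCompact_closedBall z₀ z₀.2 m, fun y hy => hy.1,
      fun L γ hL hγ h0 h1 => ?_⟩
    · refine disjoint_iff_inter_eq_empty.1 ((Metric.closedBall_disjoint_closedBall
        (δ := r) (ε := r) (by linarith)).mono Metric.closure_ball_subset_closedBall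
        Metric.closure_ball_subset_closedBall)
    · obtain ⟨s, hs, hlt⟩ := hcon L γ hL hγ (Metric.ball_subset_ball hr1 h0)
        (Metric.ball_subset_ball hr1 h1)
      exact ⟨γ s, mem_image_of_mem _ hs, hγ.1 hs, hlt.le⟩
  choose L γ hL hγ h0 h1 hfar using hex
  obtain ⟨φ, hφ, τ, hx, hy⟩ := exists_subseq_pointsConverge_pair H hδ (z₀ := z₀)
    (x := fun k => ⟨γ k 0, (hγ k).1 ⟨le_rfl, hL k⟩⟩)
    (y := fun k => ⟨γ k (L k), (hγ k).1 ⟨hL k, le_rfl⟩⟩)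
    (fun k => ⟨hL k, hγ k, rfl, rfl⟩) hfar
  have hlim := tendsto_one_div_add_atTop_nhds_zero_nat (𝕜 := ℝ)
  have hp' : Tendsto (fun k => γ k 0) atTop (𝓝 p) :=
    tendsto_iff_dist_tendsto_zero.2 (squeeze_zero (fun _ => dist_nonneg) (fun k => (h0 k).le) hlim)
  have hq' : Tendsto (fun k => γ k (L k)) atTop (𝓝 q) :=
    tendsto_iff_dist_tendsto_zero.2 (squeeze_zero (fun _ => dist_nonneg) (fun k => (h1 k).le) hlim)
  exact hpq ((tendsto_nhds_unique (hp'.comp hφ.tendsto_atTop) (hΦ.tendsto_points hx)).trans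
    (tendsto_nhds_unique (hΦ.tendsto_points hy) (hq'.comp hφ.tendsto_atTop)))

end IsContinuousSurjectiveExtension

end Visibility

/-! ### Injectivity of the extension and geodesic loops. -/

section GeodesicLoops

variable {n : ℕ} {D : Set (CSpace n)} {z₀ : D}

lemma clusterSet_eq_singleton {l : Filter ℝ} [l.NeBot] {g : ℝ → CSpace n} {p : CSpace n}
    (hp : p ∈ closure D) (h : Tendsto g l (𝓝 p)) : clusterSet D l g = {p} := by
  ext q
  constructor
  · rintro ⟨-, hq⟩
    have : (𝓝 q ⊓ 𝓝 p).NeBot := NeBot.mono hq (inf_le_inf_left _ h)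
    exact eq_of_nhds_neBot this
  · rintro rfl
    exact ⟨hp, h.mapClusterPt⟩

lemma GromovCompactification.continuous_inner : Continuous (GromovCompactification.inner (D := D) (z₀ := z₀)) :=
  continuous_def.2 fun _ hW => hW.1

namespace IsGeodesicLine

variable {g : ℝ → CSpace n}

lemma exists_tendsto (hg : IsGeodesicLine D g) (H : IsProperGeodesic D)
    (hv : HasVisibilityProperty D) :
    ∃ p ∈ frontier D, ∃ q ∈ frontier D, Tendsto g atTop (𝓝 p) ∧ Tendsto g atBot (𝓝 q) := by
  obtain ⟨p, hp, hgp⟩ := H.exists_tendsto_of_ray hv (IsGeodesicOn.mono hg (subset_univ _))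
  obtain ⟨q, hq, hgq⟩ := H.exists_tendsto_of_ray hv
    (IsGeodesicOn.comp_neg (J := Ici 0) hg fun _ _ => mem_univ _)
  refine ⟨p, hp, q, hq, hgp, ?_⟩
  simpa only [Function.comp_def, neg_neg] using hgq.comp tendsto_neg_atBot_atTop

end IsGeodesicLine

namespace IsContinuousSurjectiveExtension

variable {Φ : GromovCompactification D z₀ → closure D}

/-- Geodesic rays land at the images of their classes. -/
lemma tendsto_ray (hΦ : IsContinuousSurjectiveExtension Φ) (H : IsProperGeodesic D)
    {δ : ℝ} (hδ : HasSlimTriangles D δ) (η : GeodesicRay D z₀) :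
    Tendsto η.1 atTop
      (𝓝 (Φ (GromovCompactification.ideal (Quotient.mk _ η)) : CSpace n)) := by
  obtain ⟨p, -, hp⟩ := H.exists_tendsto_of_ray (hΦ.hasVisibilityProperty H hδ) η.2.1
  -- The ray lands somewhere by visibility, so it is enough to find the limit along integer times,
  -- where `η` itself supplies all the geodesics from `z₀`.
  have h1 := hΦ.tendsto_points (pointsConverge_of_tendsto H hδ
    (z := fun k : ℕ => ⟨η.1 k, η.mem k.cast_nonneg⟩) (α := fun _ => η.1)
    (fun k => η.isGeodesicJoining k.cast_nonneg) tendsto_natCast_atTop_atTop (η := η)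
    fun _ _ hu => Eventually.of_forall fun _ _ _ => refl_mem_uniformity hu)
  rwa [← tendsto_nhds_unique (hp.comp tendsto_natCast_atTop_atTop) h1]

lemma ideal_mem_frontier (hΦ : IsContinuousSurjectiveExtension Φ) (H : IsProperGeodesic D)
    {δ : ℝ} (hδ : HasSlimTriangles D δ) (σ : GromovBoundary D z₀) :
    (Φ (GromovCompactification.ideal σ) : CSpace n) ∈ frontier D := by
  obtain ⟨η, rfl⟩ := Quotient.exists_rep σ
  exact H.mem_frontier (Subtype.coe_prop _) (H.notMem_of_tendsto z₀.2 (hΦ.tendsto_ray H hδ η)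
    (H.tendsto_dist_of_ray z₀.2 η.2.1))

/-- The Gromov compactification being sequentially compact, the extension is a closed map. -/
theorem isClosedMap (hΦ : IsContinuousSurjectiveExtension Φ) (H : IsProperGeodesic D)
    {δ : ℝ} (hδ : HasSlimTriangles D δ) : IsClosedMap Φ := by
  intro C hC
  refine IsSeqClosed.isClosed fun x p hx hp => ?_
  choose y hyC hyx using hx
  have hcases : ∃ᶠ k in atTop, (∃ z, y k = GromovCompactification.inner z) ∨
      ∃ s, y k = GromovCompactification.ideal s := by
    refine Frequently.of_forall fun k => ?_
    cases y k with
    | inner z => exact Or.inl ⟨z, rfl⟩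
    | ideal s => exact Or.inr ⟨s, rfl⟩
  rcases frequently_or_distrib.1 hcases with h | h
  · obtain ⟨φ, hφ, hz⟩ := extraction_of_frequently_atTop h
    choose z hz using hz
    have hzC : ∀ k, GromovCompactification.inner (z k) ∈ C := fun k => hz k ▸ hyC (φ k)
    have hzp : Tendsto (fun k => (z k : CSpace n)) atTop (𝓝 p) := by
      have := ((continuous_subtype_val.tendsto p).comp hp).comp hφ.tendsto_atTop
      simpa only [Function.comp_def, ← hyx, hz, hΦ.2.2] using this
    by_cases hpD : (p : CSpace n) ∈ D
    · refine ⟨GromovCompactification.inner ⟨p, hpD⟩, ?_, Subtype.ext (hΦ.2.2 _)⟩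
      exact hC.mem_of_tendsto ((GromovCompactification.continuous_inner.tendsto _).comp
        (tendsto_subtype_rng.2 hzp)) (Eventually.of_forall hzC)
    · obtain ⟨ψ, hψ, σ, hσ⟩ := exists_subseq_pointsConverge H hδ (z₀ := z₀) (z := z)
        (H.tendsto_atTop_of_tendsto z₀.2 hpD hzp (Eventually.of_forall fun k => (z k).2))
      refine ⟨GromovCompactification.ideal σ,
        hC.mem_of_tendsto hσ.tendsto (Eventually.of_forall fun k => hzC _), Subtype.ext ?_⟩
      exact tendsto_nhds_unique (hΦ.tendsto_points hσ) (hzp.comp hψ.tendsto_atTop)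
  · obtain ⟨φ, hφ, hs⟩ := extraction_of_frequently_atTop h
    choose s hs using hs
    obtain ⟨ψ, hψ, σ, hσ⟩ := exists_subseq_classesConverge H hδ s
    have hsC : ∀ k, GromovCompactification.ideal (s k) ∈ C := fun k => hs k ▸ hyC (φ k)
    refine ⟨GromovCompactification.ideal σ,
      hC.mem_of_tendsto hσ.tendsto (Eventually.of_forall fun k => hsC _), ?_⟩
    refine tendsto_nhds_unique ((hΦ.1.tendsto _).comp hσ.tendsto) ?_
    have := (hp.comp hφ.tendsto_atTop).comp hψ.tendsto_atTop
    simpa only [Function.comp_def, ← hyx, hs] using this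

/-- If the extension is injective, then there are no geodesic loops. -/
theorem hasNoGeodesicLoops (hΦ : IsContinuousSurjectiveExtension Φ) (H : IsProperGeodesic D)
    {δ : ℝ} (hδ : HasSlimTriangles D δ) (hinj : Function.Injective Φ) : HasNoGeodesicLoops D := by
  rintro ⟨g, hg, hcl⟩
  obtain ⟨p, hp, q, hq, hgp, hgq⟩ := hg.exists_tendsto H (hΦ.hasVisibilityProperty H hδ)
  rw [clusterSet_eq_singleton (frontier_subset_closure hp) hgp,
    clusterSet_eq_singleton (frontier_subset_closure hq) hgq, singleton_eq_singleton_iff] at hcl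
  subst hcl
  have hgD : ∀ t, g t ∈ D := fun t => hg.1 (mem_univ t)
  have hcast := tendsto_natCast_atTop_atTop (R := ℝ)
  have hgp' : Tendsto (fun k : ℕ => g k) atTop (𝓝 p) := hgp.comp hcast
  have hgq' : Tendsto (fun k : ℕ => g (-k)) atTop (𝓝 p) :=
    hgq.comp (tendsto_neg_atTop_atBot.comp hcast)
  have hp' : p ∉ D := (H.isOpen.frontier_eq ▸ hp).2
  have ha := H.tendsto_atTop_of_tendsto z₀.2 hp' hgp' (Eventually.of_forall fun k => hgD _)
  have hb := H.tendsto_atTop_of_tendsto z₀.2 hp' hgq' (Eventually.of_forall fun k => hgD _)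
  choose α hα using fun k : ℕ => H.exists_geodesic z₀ z₀.2 (g k) (hgD _)
  choose β hβ using fun k : ℕ => H.exists_geodesic z₀ z₀.2 (g (-k)) (hgD _)
  obtain ⟨φ, hφ, η, hη⟩ := H.exists_subseq_ray (fun k => (hα k).1) ha
    (fun k => (hα k).2.1) (fun k => (hα k).2.2.1)
  obtain ⟨ψ, hψ, η', hη'⟩ := H.exists_subseq_ray (fun k => (hβ (φ k)).1)
    (hb.comp hφ.tendsto_atTop) (fun k => (hβ (φ k)).2.1) (fun k => (hβ (φ k)).2.2.1)
  have hηψ := fun T => (hη T).comp_strictMono hψ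
  have hφψ : Tendsto (fun j => φ (ψ j)) atTop atTop := (hφ.comp hψ).tendsto_atTop
  have h1 := hΦ.tendsto_points (pointsConverge_of_tendsto H hδ
    (z := fun j => ⟨g (φ (ψ j)), hgD _⟩) (fun j => hα (φ (ψ j))) (ha.comp hφψ) hηψ)
  have h2 := hΦ.tendsto_points (pointsConverge_of_tendsto H hδ
    (z := fun j => ⟨g (-(φ (ψ j))), hgD _⟩) (fun j => hβ (φ (ψ j))) (hb.comp hφψ) hη')
  -- Both ends of the line tend to the same Euclidean point, so injectivity identifies the ideal
  -- points that they define.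
  have heq : η ≈ η' := by
    have := hinj (Subtype.ext ((tendsto_nhds_unique h1 (hgp'.comp hφψ)).trans
      (tendsto_nhds_unique (hgq'.comp hφψ) h2)))
    exact Quotient.exact (GromovCompactification.ideal.inj this)
  obtain ⟨M, hM⟩ := (GeodesicRay.equiv_iff H).1 heq
  have hM0 : 0 ≤ M := (kobayashiDist_nonneg D _ _).trans (hM 0 le_rfl)
  set d := kobayashiDist D z₀ (g 0) with hd
  have hd0 : 0 ≤ d := kobayashiDist_nonneg D _ _
  -- Going from `g k` along `α k` back to time `T`, across to `β k`, and on to `g (-k)` costs less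
  -- than `2(d + k - T) + M + 1`, which is below `2k` for this `T`; but the two points are `2k`
  -- apart.
  set T := d + M + 1 with hT
  have hT0 : 0 ≤ T := by positivity
  have hlim := H.tendsto_kobayashiDist ((hηψ T).tendsto_at ⟨hT0, le_rfl⟩)
    ((hη' T).tendsto_at ⟨hT0, le_rfl⟩) (η.mem hT0) (η'.mem hT0)
  obtain ⟨j, hj, hja, hjb⟩ := ((hlim.eventually_lt_const ((hM T hT0).trans_lt (lt_add_one M))).and
    (((ha.comp hφψ).eventually_ge_atTop T).and ((hb.comp hφψ).eventually_ge_atTop T))).exists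
  set k := φ (ψ j)
  have hk : (0 : ℝ) ≤ k := k.cast_nonneg
  have e1 := H.triangle z₀.2 (hgD 0) (hgD k)
  have e2 := H.triangle z₀.2 (hgD 0) (hgD (-k))
  have e3 := H.triangle (hgD k) ((hα k).mem ⟨hT0, hja⟩) (hgD (-k))
  have e4 := H.triangle ((hα k).mem ⟨hT0, hja⟩) ((hβ k).mem ⟨hT0, hjb⟩) (hgD (-k))
  rw [hg.2 _ (mem_univ _) _ (mem_univ _), zero_sub, abs_neg, abs_of_nonneg hk] at e1
  rw [hg.2 0 (mem_univ _) _ (mem_univ _), zero_sub, neg_neg, abs_of_nonneg hk] at e2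
  rw [hg.2 _ (mem_univ _) _ (mem_univ _), sub_neg_eq_add, abs_of_nonneg (by positivity),
    kobayashiDist_comm D (g k), (hα k).dist_right ⟨hT0, hja⟩] at e3
  rw [(hβ k).dist_right ⟨hT0, hjb⟩] at e4
  linarith

end IsContinuousSurjectiveExtension

/-- Two inequivalent rays that land at the same boundary point of a visible domain give rise to a
geodesic loop. -/
theorem exists_isGeodesicLoop (H : IsProperGeodesic D) {δ : ℝ} (hδ : HasSlimTriangles D δ)
    (hv : HasVisibilityProperty D) {η η' : GeodesicRay D z₀} (hne : ¬ η ≈ η') {p : CSpace n}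
    (hp : p ∈ frontier D) (hη : Tendsto η.1 atTop (𝓝 p)) (hη' : Tendsto η'.1 atTop (𝓝 p)) :
    ∃ g, IsGeodesicLoop D g := by
  obtain ⟨T, hT0, hT⟩ : ∃ T : ℝ, 0 ≤ T ∧ 2 * δ < kobayashiDist D (η.1 T) (η'.1 T) := by
    by_contra! hcon
    exact hne ((GeodesicRay.equiv_iff H).2 ⟨2 * δ, hcon⟩)
  choose σ hσ using fun k : ℕ =>
    H.exists_geodesic _ (η.mem k.cast_nonneg) _ (η'.mem k.cast_nonneg)
  set L : ℕ → ℝ := fun k => kobayashiDist D (η.1 k) (η'.1 k)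
  replace hσ : ∀ k : ℕ, IsGeodesicJoining D (η.1 k) (η'.1 k) (L k) (σ k) := hσ
  -- Since the rays are more than `2δ` apart at time `T`, `HasSlimTriangles.dist_le_two_mul` forbids
  -- the joining geodesic to avoid the ball of radius `T + δ`.
  have hnear : ∀ k : ℕ, ∃ s ∈ Icc 0 (L k), kobayashiDist D z₀ (σ k s) ≤ T + δ := by
    intro k
    by_contra! hcon
    exact hT.not_ge (hδ.dist_le_two_mul H (η.isGeodesicJoining k.cast_nonneg)
      (η'.isGeodesicJoining k.cast_nonneg) (hσ k) hcon ⟨hT0, le_rfl⟩)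
  choose s hs hsd using hnear
  have hsD : ∀ k, σ k (s k) ∈ D := fun k => (hσ k).mem (hs k)
  have hcast := tendsto_natCast_atTop_atTop (R := ℝ)
  have hs_lim : Tendsto s atTop atTop := by
    refine tendsto_atTop_mono (fun k => ?_) (tendsto_atTop_add_const_right _ (-(T + δ)) hcast)
    have h1 := H.triangle z₀.2 (hsD k) (η.mem k.cast_nonneg)
    rw [η.dist_base k.cast_nonneg, kobayashiDist_comm D (σ k (s k)), (hσ k).dist_left (hs k)] at h1
    linarith [hsd k]
  have hL_lim : Tendsto (fun k => L k - s k) atTop atTop := by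
    refine tendsto_atTop_mono (fun k => ?_) (tendsto_atTop_add_const_right _ (-(T + δ)) hcast)
    have h1 := H.triangle z₀.2 (hsD k) (η'.mem k.cast_nonneg)
    rw [η'.dist_base k.cast_nonneg, (hσ k).dist_right (hs k)] at h1
    linarith [hsd k]
  -- Time is recentred at the passage near `z₀`. Both ends of the interval of definition run off to
  -- infinity, so the limit is a full line.
  set f : ℕ → ℝ → CSpace n := fun k t => σ k (s k + t) with hf
  have hfgeo : ∀ k, IsGeodesicOn D (Icc (-s k) (L k - s k)) (f k) := fun k =>
    (hσ k).2.1.shift (by simp) (by simp)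
  have hf0 : ∀ k, kobayashiDist D z₀ (f k 0) ≤ T + δ := fun k => by
    simpa only [hf, add_zero] using hsd k
  obtain ⟨φ, hφ, g, hgD, hg⟩ := H.exists_subseq_of_isGeodesicOn z₀.2
    (fun k => neg_nonpos.2 (hs k).1) (fun k => sub_nonneg.2 (hs k).2) hfgeo hf0
  have hsφ := hs_lim.comp hφ.tendsto_atTop
  have hLφ := hL_lim.comp hφ.tendsto_atTop
  have hdom : ∀ t : ℝ, ∀ᶠ j in atTop, t ∈ Icc (-s (φ j)) (L (φ j) - s (φ j)) := fun t => by
    filter_upwards [hsφ.eventually_ge_atTop (-t), hLφ.eventually_ge_atTop t] with j h1 h2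
    simp only [Function.comp_apply] at h1 h2
    exact ⟨by linarith, h2⟩
  have hpt : ∀ t, Tendsto (fun j => f (φ j) t) atTop (𝓝 (g t)) := fun t =>
    (hg t t (hdom t)).tendsto_at ⟨le_rfl, le_rfl⟩
  have hgline : IsGeodesicLine D g := H.isGeodesicOn_of_tendsto (fun t _ => hgD t)
    (fun t _ => hpt t) fun u _ v _ => by
      filter_upwards [hdom u, hdom v] with j hu hv
      exact (hfgeo _).2 u hu v hv
  obtain ⟨q, hq, q', hq', hgq, hgq'⟩ := hgline.exists_tendsto H hv
  have hηk : Tendsto (fun j => η.1 (φ j : ℝ)) atTop (𝓝 p) :=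
    hη.comp (hcast.comp hφ.tendsto_atTop)
  have hηk' : Tendsto (fun j => η'.1 (φ j : ℝ)) atTop (𝓝 p) :=
    hη'.comp (hcast.comp hφ.tendsto_atTop)
  -- The forward ends of the approximating geodesics are the points `η'.1 (φ j)`, which tend to `p`,
  -- so the forward end of the limit line is compared with `p`. The backward end is treated by
  -- reversing time.
  obtain rfl : q = p := by
    refine H.eq_of_mapClusterPt hv z₀.2 hq hp (γ := fun j => f (φ j)) (fun k => hf0 _)
      (fun t _ => hpt t) hgq.mapClusterPt fun V hV u => ?_
    filter_upwards [hLφ.eventually_ge_atTop u, hηk'.eventually_mem hV] with j hj hjV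
    refine ⟨_, hj, (hfgeo _).mono (Icc_subset_Icc_left (neg_nonpos.2 (hs _).1)), ?_⟩
    simpa only [hf, Function.comp_apply, add_sub_cancel, (hσ _).2.2.2] using hjV
  obtain rfl : q' = q := by
    refine H.eq_of_mapClusterPt hv z₀.2 hq' hp (γ := fun j t => f (φ j) (-t))
      (g := fun t => g (-t)) (fun k => by simpa only [neg_zero] using hf0 _)
      (fun t _ => hpt (-t)) (hgq'.comp tendsto_neg_atTop_atBot).mapClusterPt fun V hV u => ?_
    filter_upwards [hsφ.eventually_ge_atTop u, hηk.eventually_mem hV] with j hj hjV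
    refine ⟨_, hj, (hfgeo (φ j)).comp_neg fun t ht => ?_, ?_⟩
    · have h1 := (hs (φ j)).2
      exact ⟨neg_le_neg ht.2, by linarith [ht.1]⟩
    · simpa only [hf, Function.comp_apply, add_neg_cancel, (hσ _).2.2.1] using hjV
  refine ⟨g, hgline, ?_⟩
  rw [clusterSet_eq_singleton (frontier_subset_closure hq) hgq,
    clusterSet_eq_singleton (frontier_subset_closure hq) hgq']

/-- Points of `D` are fixed and ideal points go to the frontier, so only two ideal points can be
identified; their rays would then land at the same point and produce a loop. -/
theorem IsContinuousSurjectiveExtension.injective {Φ : GromovCompactification D z₀ → closure D}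
    (hΦ : IsContinuousSurjectiveExtension Φ) (H : IsProperGeodesic D) {δ : ℝ}
    (hδ : HasSlimTriangles D δ) (hloop : HasNoGeodesicLoops D) : Function.Injective Φ := by
  have hmixed : ∀ (z : D) (σ : GromovBoundary D z₀),
      Φ (GromovCompactification.inner z) ≠ Φ (GromovCompactification.ideal σ) := fun z σ h => by
    have h1 := hΦ.ideal_mem_frontier H hδ σ
    rw [← h, hΦ.2.2, H.isOpen.frontier_eq] at h1
    exact h1.2 z.2
  rintro (z | σ) (z' | σ') h
  · have h1 := congrArg (Subtype.val) h
    rw [hΦ.2.2, hΦ.2.2] at h1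
    rw [Subtype.ext h1]
  · exact absurd h (hmixed z σ')
  · exact absurd h.symm (hmixed z' σ)
  · obtain ⟨η, rfl⟩ := Quotient.exists_rep σ
    obtain ⟨η', rfl⟩ := Quotient.exists_rep σ'
    by_contra hne
    refine hloop (exists_isGeodesicLoop H hδ (hΦ.hasVisibilityProperty H hδ) (η := η) (η' := η')
      (fun heq => hne (by rw [Quotient.sound heq])) (hΦ.ideal_mem_frontier H hδ _)
      (hΦ.tendsto_ray H hδ η) ?_)
    rw [h]
    exact hΦ.tendsto_ray H hδ η'

end GeodesicLoops

theorem mainTheorem5 {n : ℕ} (D : Set (CSpace n)) (hD_open : IsOpen D) (hD_conn : IsConnected D)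
    (hD_bdd : Bornology.IsBounded D) (hD_complete : IsCompleteHyperbolic D)
    (hD_gromov : IsGromovHyperbolic D) (z₀ : D) :
    (HasVisibilityProperty D ↔
      ∃ Φ : GromovCompactification D z₀ → closure D, IsContinuousSurjectiveExtension Φ) ∧
    (∀ Φ : GromovCompactification D z₀ → closure D, IsContinuousSurjectiveExtension Φ →
      (IsHomeomorph Φ ↔ HasNoGeodesicLoops D)) := by
  have H := hD_complete.isProperGeodesic hD_open hD_conn.isPreconnected hD_bdd
  obtain ⟨δ, hδ⟩ : ∃ δ, HasSlimTriangles D δ := hD_gromov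
  refine ⟨⟨H.exists_extension hδ, fun ⟨Φ, hΦ⟩ => hΦ.hasVisibilityProperty H hδ⟩,
    fun Φ hΦ => ⟨fun h => hΦ.hasNoGeodesicLoops H hδ h.injective, fun h => ?_⟩⟩
  exact isHomeomorph_iff_continuous_isClosedMap_bijective.2
    ⟨hΦ.1, hΦ.isClosedMap H hδ, hΦ.injective H hδ h, hΦ.2.1⟩
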